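/- A one-way nondeterministic stack automaton $M$ has a finite state set $Q$, a finite input alphabet $\Sigma$, a finite stack alphabet $\Gamma$, an initial state, an initial stack symbol (the initial stack content), a set of final states and a finite set of transitions. In a transition $M$ reads one input letter or the empty word, and, depending on its state, on the stack symbol scanned by the stack head and on whether the head is at the top of the stack, it changes state and either leaves the stack and the head as they are, or moves the head one cell down or up inside the stack without changing the stack, or, if the head is at the top, replaces the topmost symbol by a word $\gamma\in\Gamma^*$ and puts the head on the new top (a move down if $\gamma$ is empty, no move if $|\gamma|=1$, a move up if $|\gamma|\ge 2$). No transition applies when the stack is empty. A word of $\Sigma^*$ is accepted if some computation on it, started in the initial state with the head on the initial stack symbol, consumes the whole input and ends in a final state; $L(M)\subseteq\Sigma^*$ is the set of accepted words. $M$ is reversal-bounded if there is a $k$ such that in every accepting computation the stack head changes its direction between moving up and moving down at most $k$ times. A language $L\subseteq\Sigma^*$ is dense if every word of $\Sigma^*$ is an infix of some word of $L$. **Corollary.** It is decidable, given a reversal-bounded one-way nondeterministic stack automaton $M$, whether $L(M)$ is dense: there is an algorithm that, given (a finite description of) any such $M$, halts and answers correctly whether $L(M)$ is dense. (The bound $k$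 is not part of the input; nothing is required of the algorithm on automata that are not reversal-bounded.) -/

import Mathlib

/-- What a transition of a stack automaton does to the stack and to the stack head. -/
inductive StackAction (G : Type) : Type where
  /-- Neither the stack nor the stack head changes. -/
  | stay : StackAction G
  /-- The head moves one cell down (into the stack); nothing is rewritten. -/
  | down : StackAction G
  /-- The head moves one cell up (towards the top); nothing is rewritten. -/
  | up : StackAction G
  /-- Replace the topmost symbol by the word `γ`, listed from the new top downwards, and put the
  head on the new top. Possible only if the head is at the top of the stack. -/
  | write (γ : List G) : StackAction G

/-- The direction in which the stack head moves: `some true` is up, `some false` is down, `none`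
is no movement. Replacing the top symbol by a word of length 0, 1, or at least 2 moves the head
down, not at all, or up. -/
def StackAction.direction {G : Type} : StackAction G → Option Bool
  | .stay => none
  | .down => some false
  | .up => some true
  | .write [] => some false
  | .write [_] => none
  | .write (_ :: _ :: _) => some true

/-- A transition: in state `src`, reading `input` (a letter, or `none` for the empty word), with the
stack head scanning `scanned`, and being at the top of the stack if and only if `atTop = true`, go
to state `dst` and perform `action`. -/
structure StackTransition (Q A G : Type) : Type where
  src : Q
  input : Option A
  atTop : Bool
  scanned : G
  dst : Q
  action : StackAction G

/-- A one-way nondeterministic stack automaton with states `Q`, input alphabet `A` and stack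
alphabet `G`. The finite transition relation and the set of final states are given by lists. -/
structure StackAutomaton (Q A G : Type) : Type where
  start : Q
  bottom : G
  final : List Q
  transitions : List (StackTransition Q A G)

/-- A configuration: the state, the remaining input, and the stack content, split at the head.
The list `below` starts with the scanned symbol and goes on downwards to the bottom of the stack;
the list `above` holds the symbols above the scanned one, going upwards to the top. -/
structure StackConfig (Q A G : Type) : Type where
  state : Q
  input : List A
  above : List G
  below : List G

/-- `StackMove act u b u' b'`: the action `act` turns the stack `u`, `b` (symbols above the head, and
scanned symbol with the symbols below it) into `u'`, `b'`. -/
inductive StackMove {G : Type} : StackAction G → List G → List G → List G → List G → Prop where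
  | stay (Z : G) (u b : List G) : StackMove .stay u (Z :: b) u (Z :: b)
  | down (Z Y : G) (u b : List G) : StackMove .down u (Z :: Y :: b) (Z :: u) (Y :: b)
  | up (Z Y : G) (u b : List G) : StackMove .up (Y :: u) (Z :: b) u (Y :: Z :: b)
  | write (Z : G) (γ b : List G) : StackMove (.write γ) [] (Z :: b) [] (γ ++ b)

/-- The number of positions at which two consecutive entries of a list of directions differ. -/
def directionChanges : List Bool → ℕ
  | [] => 0
  | [_] => 0
  | c :: d :: l => (if c = d then 0 else 1) + directionChanges (d :: l)

namespace StackAutomaton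

variable {Q A G : Type}

/-- `M.Step t C C'`: the transition `t` of `M` leads from configuration `C` to `C'`. -/
def Step (M : StackAutomaton Q A G) (t : StackTransition Q A G) (C C' : StackConfig Q A G) : Prop :=
  t ∈ M.transitions ∧
  C.state = t.src ∧ C'.state = t.dst ∧
  C.input = t.input.toList ++ C'.input ∧
  C.below.head? = some t.scanned ∧
  (t.atTop = true ↔ C.above = []) ∧
  StackMove t.action C.above C.below C'.above C'.below

/-- `M.Run C ds C'`: there is a computation of `M` (finitely many steps, possibly none) from `C` to
`C'` in which the successive movements of the stack head have the directions `ds` (steps in which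
the head does not move are left out of `ds`). -/
inductive Run (M : StackAutomaton Q A G) :
    StackConfig Q A G → List Bool → StackConfig Q A G → Prop where
  | refl (C : StackConfig Q A G) : Run M C [] C
  | step {C C' C'' : StackConfig Q A G} {t : StackTransition Q A G} {ds : List Bool} :
      M.Step t C C' → Run M C' ds C'' → Run M C (t.action.direction.toList ++ ds) C''

/-- The initial configuration on input `w`: the stack holds only the bottom symbol. -/
def initial (M : StackAutomaton Q A G) (w : List A) : StackConfig Q A G :=
  ⟨M.start, w, [], [M.bottom]⟩

/-- `M` has an accepting computation on `w` in which the head moves in the directions `ds`: the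
input is consumed and a final state is reached, with any stack. -/
def AcceptsWith (M : StackAutomaton Q A G) (w : List A) (ds : List Bool) : Prop :=
  ∃ C : StackConfig Q A G, M.Run (M.initial w) ds C ∧ C.input = [] ∧ C.state ∈ M.final

/-- The language accepted by `M`. -/
def language (M : StackAutomaton Q A G) : Language A :=
  {w | ∃ ds : List Bool, M.AcceptsWith w ds}

/-- `M` is reversal-bounded: there is a `k` such that in every accepting computation the stack head
changes its direction at most `k` times. -/
def ReversalBounded (M : StackAutomaton Q A G) : Prop :=
  ∃ k : ℕ, ∀ (w : List A) (ds : List Bool), M.AcceptsWith w ds → directionChanges ds ≤ k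

end StackAutomaton

/-- The set of all infixes of words of `L`. -/
def infixes {A : Type} (L : Language A) : Language A :=
  {y | ∃ w ∈ L, y <:+: w}

/-- A language over `A` is dense if every word over `A` is an infix of one of its words. -/
def DenseLanguage {A : Type} (L : Language A) : Prop :=
  infixes L = (Set.univ : Set (List A))

/-- Finite descriptions of stack automata: the numbers of states, input letters and stack symbols,
the start state, the bottom symbol, the final states, and the transitions (source, input, top flag,
scanned symbol, target, action). -/
abbrev StackAutomatonCode : Type :=
  ℕ × ℕ × ℕ × ℕ × ℕ × List ℕ × List (ℕ × Option ℕ × Bool × ℕ × ℕ × ℕ × List ℕ)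

/-- Numerical description of an action. -/
def StackAction.encode {g : ℕ} : StackAction (Fin g) → ℕ × List ℕ
  | .stay => (0, [])
  | .down => (1, [])
  | .up => (2, [])
  | .write γ => (3, γ.map Fin.val)

/-- Numerical description of a transition. -/
def StackTransition.encode {q s g : ℕ} (t : StackTransition (Fin q) (Fin s) (Fin g)) :
    ℕ × Option ℕ × Bool × ℕ × ℕ × ℕ × List ℕ :=
  (t.src.val, t.input.map Fin.val, t.atTop, t.scanned.val, t.dst.val, t.action.encode)

/-- The description of a stack automaton whose states, input letters and stack symbols are
numbered. -/
def StackAutomaton.encode {q s g : ℕ} (M : StackAutomaton (Fin q) (Fin s) (Fin g)) :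
    StackAutomatonCode :=
  (q, s, g, M.start.val, M.bottom.val, M.final.map Fin.val,
    M.transitions.map StackTransition.encode)

/-! The automaton is compiled into a machine with elementary moves: reading inside the stack
(`look`), reading at the top (`top`), moving up or down, pushing and popping. A stretch of a
computation in which the head moves in one direction only, and stays at the top or stays below it,
uses one reading kind and one moving kind; this gives four modes. For a mode, the segment language
consists of the words read during such a stretch of an accepting computation; it is closed under
infixes. While the direction is constant, the head changes between top and interior at most once, so
an accepting computation with at most `k` direction changes cuts the input into at most `2 * k + 2`
words from segment languages (`AcceptsWith.segmentWords`).

Hence `dense_iff`: the language is dense exactly if one of the four segment languages contains every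
word. If each mode misses some word, let `z` be the concatenation of four missing words. If `z ^ (2
* k + 3)` were an infix of an accepted word, one copy of `z` would lie inside one segment, and the
word missing for the mode of that segment would be in its segment language after all. The other
direction needs no reversal bound.

Universality of a segment language can be tested on finitely many words. The rest of a computation
notices only finitely much of a lower part of the stack: its top symbol, the state changes possible
inside it, and the states in which it is reachable or co-reachable with nothing above it
(`stackType`). Pushing respects this type (`stackType_cons`). So the set of types of the situations
in which a word may have been read is a right-invariant with finitely many values
(`pushTypes_append_subset`, `climbTypes_append_subset`), and by pigeonhole a shortest missing word
has length at most the computable `witnessBound`. The types themselves need not be computed for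
this. Running the machine backwards exchanges push with pop and up with down, so that two modes
suffice.

Membership of one word in a segment language is acceptance by another elementary machine, which
counts the letters read (`segmentList_coReach_iff`). Acceptance has finite certificates
(`Certifies`). So does non-acceptance: a finite table, essentially an automaton reading stacks, that
bounds the co-reachable configurations from above (`Refutes`); the stack types supply such a table
when one should exist. Thus density and its negation both have evidence that is checked primitive
recursively, and the algorithm searches for either kind. -/

/-! ### Paths in labelled relations -/

/-- A word `w` is read along a path of steps of the labelled relation `R` whose kinds lie in `κ`. -/
inductive LabelledPath {C A : Type*} (R : ℕ → Option A → C → C → Prop) (κ : Set ℕ) :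
    C → List A → C → Prop where
  | refl (c : C) : LabelledPath R κ c [] c
  | cons {c c' c'' : C} {k : ℕ} {a : Option A} {w : List A} :
      k ∈ κ → R k a c c' → LabelledPath R κ c' w c'' → LabelledPath R κ c (a.toList ++ w) c''

namespace LabelledPath

variable {C A : Type*} {R : ℕ → Option A → C → C → Prop} {κ κ' : Set ℕ}

theorem trans {c c' c'' : C} {v w : List A} (h : LabelledPath R κ c v c')
    (h' : LabelledPath R κ c' w c'') : LabelledPath R κ c (v ++ w) c'' := by
  induction h with
  | refl c => exact h'
  | cons hk hs _ ih => rw [List.append_assoc]; exact .cons hk hs (ih h')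

theorem single {c c' : C} {k : ℕ} {a : Option A} (hk : k ∈ κ) (h : R k a c c') :
    LabelledPath R κ c a.toList c' := by
  simpa using LabelledPath.cons hk h (.refl c')

theorem cons_none {c c' c'' : C} {k : ℕ} {w : List A} (hk : k ∈ κ) (h : R k none c c')
    (h' : LabelledPath R κ c' w c'') : LabelledPath R κ c w c'' :=
  .cons hk h h'

theorem snoc {c c' c'' : C} {k : ℕ} {a : Option A} {w : List A} (h : LabelledPath R κ c w c')
    (hk : k ∈ κ) (h' : R k a c' c'') : LabelledPath R κ c (w ++ a.toList) c'' :=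
  h.trans (single hk h')

theorem mono (hκ : κ ⊆ κ') {c c' : C} {w : List A} (h : LabelledPath R κ c w c') :
    LabelledPath R κ' c w c' := by
  induction h with
  | refl c => exact .refl c
  | cons hk hs _ ih => exact .cons (hκ hk) hs ih

/-- Induction on a path that removes the last step. -/
theorem snoc_induction {c : C} {P : ∀ w c', LabelledPath R κ c w c' → Prop}
    (hrefl : P [] c (.refl c))
    (hsnoc : ∀ {w c' c'' k a} (h : LabelledPath R κ c w c') (hk : k ∈ κ) (hs : R k a c' c''),
      P w c' h → P (w ++ a.toList) c'' (h.snoc hk hs))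
    {w : List A} {c' : C} (h : LabelledPath R κ c w c') : P w c' h := by
  suffices H : ∀ {c₁ w c'}, LabelledPath R κ c₁ w c' → ∀ v (hv : LabelledPath R κ c v c₁),
      P v c₁ hv → ∀ h, P (v ++ w) c' h from H h [] (.refl c) hrefl h
  intro c₁ w c' h
  induction h with
  | refl c₁ =>
    intro v _ hv
    rw [List.append_nil]
    exact fun _ => hv
  | cons hk hs _ ih =>
    intro v hv hP
    rw [← List.append_assoc]
    exact ih _ (hv.snoc hk hs) (hsnoc hv hk hs hP)

theorem exists_split {c c' : C} {w : List A} (h : LabelledPath R κ c w c') :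
    ∀ x y, w = x ++ y → ∃ d, LabelledPath R κ c x d ∧ LabelledPath R κ d y c' := by
  induction h with
  | refl c =>
    intro x y hxy
    obtain ⟨rfl, rfl⟩ := List.append_eq_nil_iff.1 hxy.symm
    exact ⟨c, .refl c, .refl c⟩
  | @cons c c₁ c₂ k a w hk hs hp ih =>
    intro x y hxy
    cases a with
    | none =>
      obtain ⟨d, h₁, h₂⟩ := ih x y hxy
      exact ⟨d, .cons_none hk hs h₁, h₂⟩
    | some a =>
      cases x with
      | nil => exact ⟨c, .refl c, by simp only [List.nil_append] at hxy; exact hxy ▸ .cons hk hs hp⟩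
      | cons a' x =>
        simp only [Option.toList_some, List.cons_append, List.nil_append, List.cons.injEq] at hxy
        obtain ⟨rfl, rfl⟩ := hxy
        obtain ⟨d, h₁, h₂⟩ := ih x y rfl
        exact ⟨d, .cons (a := some a) hk hs h₁, h₂⟩

end LabelledPath

/-! ### Elementary stack machines, time reversal and segment languages -/

/-- A stack machine with elementary moves, each of which has an elementary inverse:
`look` tests the scanned symbol below the top, `top` replaces the top symbol, `up` and `down` move
the head inside the stack, `push` and `pop` act with the head at the top. It starts in `start` and
accepts in `fin`, both with the empty stack. -/
structure ElemMachine (S G A : Type*) where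
  start : S
  fin : S
  look : S → Option A → G → S → Prop
  top : S → Option A → G → G → S → Prop
  up : S → S → Prop
  down : S → S → Prop
  push : S → G → S → Prop
  pop : S → G → S → Prop

namespace ElemMachine

variable {S G A : Type*}

/-- A single step. The number is the kind of the move. -/
inductive Step (M : ElemMachine S G A) :
    ℕ → Option A → S × List G × List G → S × List G × List G → Prop where
  | look {p q : S} {a : Option A} {Z : G} (Y : G) (u b : List G) :
      M.look p a Z q → Step M 0 a (p, Y :: u, Z :: b) (q, Y :: u, Z :: b)
  | top {p q : S} {a : Option A} {Z Y : G} (b : List G) :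
      M.top p a Z Y q → Step M 1 a (p, [], Z :: b) (q, [], Y :: b)
  | up {p q : S} (Z Y : G) (u b : List G) :
      M.up p q → Step M 2 none (p, Y :: u, Z :: b) (q, u, Y :: Z :: b)
  | down {p q : S} (Z Y : G) (u b : List G) :
      M.down p q → Step M 3 none (p, u, Y :: Z :: b) (q, Y :: u, Z :: b)
  | push {p q : S} {X : G} (b : List G) : M.push p X q → Step M 4 none (p, [], b) (q, [], X :: b)
  | pop {p q : S} {X : G} (b : List G) : M.pop p X q → Step M 5 none (p, [], X :: b) (q, [], b)

/-- A step of any kind with any label. -/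
def Move (M : ElemMachine S G A) (c c' : S × List G × List G) : Prop :=
  ∃ k a, M.Step k a c c'

/-- Configurations reachable from the initial one. -/
def Reach (M : ElemMachine S G A) (c : S × List G × List G) : Prop :=
  Relation.ReflTransGen M.Move (M.start, [], []) c

/-- Configurations from which the accepting one is reachable. -/
def CoReach (M : ElemMachine S G A) (c : S × List G × List G) : Prop :=
  Relation.ReflTransGen M.Move c (M.fin, [], [])

/-- The words read in accepting computations during a segment that uses moves of kind `κ` only. -/
def segmentLang (M : ElemMachine S G A) (κ : Set ℕ) : Set (List A) :=
  {w | ∃ c c', M.Reach c ∧ LabelledPath M.Step κ c w c' ∧ M.CoReach c'}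

/-- The machine that runs backwards. -/
def rev (M : ElemMachine S G A) : ElemMachine S G A where
  start := M.fin
  fin := M.start
  look p a Z q := M.look q a Z p
  top p a Z Y q := M.top q a Y Z p
  up p q := M.down q p
  down p q := M.up q p
  push p X q := M.pop q X p
  pop p X q := M.push q X p

/-- The kind of the inverse move. -/
def revKind : ℕ → ℕ
  | 2 => 3
  | 3 => 2
  | 4 => 5
  | 5 => 4
  | n => n

variable {M : ElemMachine S G A}

theorem rev_rev (M : ElemMachine S G A) : M.rev.rev = M := rfl

theorem Step.rev {k : ℕ} {a : Option A} {c c' : S × List G × List G} (h : M.Step k a c c') :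
    M.rev.Step (revKind k) a c' c := by
  cases h with
  | look Y u b h => exact .look Y u b h
  | top b h => exact .top b h
  | up Z Y u b h => exact .down Z Y u b h
  | down Z Y u b h => exact .up Z Y u b h
  | push b h => exact .pop b h
  | pop b h => exact .push b h

theorem Step.move {k : ℕ} {a : Option A} {c c' : S × List G × List G} (h : M.Step k a c c') :
    M.Move c c' := ⟨k, a, h⟩

theorem Move.rev {c c' : S × List G × List G} (h : M.Move c c') : M.rev.Move c' c :=
  h.elim fun _ h => h.elim fun _ h => h.rev.move

theorem reflTransGen_rev {c c' : S × List G × List G} (h : Relation.ReflTransGen M.Move c c') :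
    Relation.ReflTransGen M.rev.Move c' c := by
  induction h with
  | refl => exact .refl
  | tail _ h ih => exact .head h.rev ih

theorem reach_rev {c : S × List G × List G} : M.rev.Reach c ↔ M.CoReach c :=
  ⟨fun h => reflTransGen_rev (M := M.rev) h, fun h => reflTransGen_rev h⟩

theorem coReach_rev {c : S × List G × List G} : M.rev.CoReach c ↔ M.Reach c :=
  ⟨fun h => reflTransGen_rev (M := M.rev) h, fun h => reflTransGen_rev h⟩

theorem path_rev {κ κ' : Set ℕ} (hκ : ∀ k ∈ κ, revKind k ∈ κ') {c c' : S × List G × List G}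
    {w : List A} (h : LabelledPath M.Step κ c w c') :
    LabelledPath M.rev.Step κ' c' w.reverse c := by
  induction h with
  | refl c => exact .refl c
  | @cons c c₁ c₂ k a w hk hs _ ih =>
    have := ih.snoc (hκ _ hk) hs.rev
    cases a <;> simpa using this

/-- Time reversal turns popping segments into pushing ones and downward segments into upward ones,
so only two of the four modes have to be analysed directly. -/
theorem segmentLang_rev {κ κ' : Set ℕ} (hκ : ∀ k ∈ κ, revKind k ∈ κ')
    (hκ' : ∀ k ∈ κ', revKind k ∈ κ) (w : List A) :
    w ∈ M.segmentLang κ ↔ w.reverse ∈ M.rev.segmentLang κ' := by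
  constructor
  · rintro ⟨c, c', h₁, h₂, h₃⟩
    exact ⟨c', c, reach_rev.2 h₃, path_rev hκ h₂, coReach_rev.2 h₁⟩
  · rintro ⟨c, c', h₁, h₂, h₃⟩
    refine ⟨c', c, coReach_rev.1 h₃, ?_, reach_rev.1 h₁⟩
    have := path_rev (M := M.rev) hκ' h₂
    simpa [rev_rev] using this

theorem reflTransGen_of_path {κ : Set ℕ} {c c' : S × List G × List G} {w : List A}
    (h : LabelledPath M.Step κ c w c') : Relation.ReflTransGen M.Move c c' := by
  induction h with
  | refl c => exact .refl
  | cons _ hs _ ih => exact .head hs.move ih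

theorem exists_path {c c' : S × List G × List G} (h : Relation.ReflTransGen M.Move c c') :
    ∃ w, LabelledPath M.Step Set.univ c w c' := by
  induction h using Relation.ReflTransGen.head_induction_on with
  | refl => exact ⟨[], .refl _⟩
  | head h _ ih =>
    obtain ⟨k, a, h⟩ := h
    obtain ⟨w, ih⟩ := ih
    exact ⟨_, .cons (Set.mem_univ k) h ih⟩

/-- The outer parts of the segment are absorbed into the computations that lead to it and away from
it, which are unrestricted. -/
theorem segmentLang_infix {κ : Set ℕ} {x y z : List A} (h : x ++ y ++ z ∈ M.segmentLang κ) :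
    y ∈ M.segmentLang κ := by
  obtain ⟨c, c', h₁, h₂, h₃⟩ := h
  obtain ⟨e, h₄, h₅⟩ := h₂.exists_split _ _ rfl
  obtain ⟨d, h₆, h₇⟩ := h₄.exists_split _ _ rfl
  exact ⟨d, e, h₁.trans (reflTransGen_of_path h₆), h₇, (reflTransGen_of_path h₅).trans h₃⟩

/-- A step with the head inside a fixed part of the stack, below symbols that are not shown. -/
inductive InStep (M : ElemMachine S G A) : S × List G × List G → S × List G × List G → Prop where
  | look {p q : S} {a : Option A} {Z : G} (u b : List G) :
      M.look p a Z q → InStep M (p, u, Z :: b) (q, u, Z :: b)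
  | up {p q : S} (Z Y : G) (u b : List G) :
      M.up p q → InStep M (p, Y :: u, Z :: b) (q, u, Y :: Z :: b)
  | down {p q : S} (Z Y : G) (u b : List G) :
      M.down p q → InStep M (p, u, Y :: Z :: b) (q, Y :: u, Z :: b)

/-- `M.Inner b p q`: with the head on the top cell of `b` and more symbols above, `M` can get from
state `p` to state `q`, the head being on the top cell of `b` again, without leaving `b`. -/
def Inner (M : ElemMachine S G A) (b : List G) (p q : S) : Prop :=
  Relation.ReflTransGen M.InStep (p, [], b) (q, [], b)

theorem InStep.rev {c c' : S × List G × List G} (h : M.InStep c c') : M.rev.InStep c' c := by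
  cases h with
  | look u b h => exact .look u b h
  | up Z Y u b h => exact .down Z Y u b h
  | down Z Y u b h => exact .up Z Y u b h

theorem inStep_rev {c c' : S × List G × List G} (h : Relation.ReflTransGen M.InStep c c') :
    Relation.ReflTransGen M.rev.InStep c' c := by
  induction h with
  | refl => exact .refl
  | tail _ h ih => exact .head h.rev ih

theorem inner_rev {b : List G} {p q : S} : M.rev.Inner b p q ↔ M.Inner b q p :=
  ⟨fun h => inStep_rev (M := M.rev) h, fun h => inStep_rev h⟩

/-- Computations inside a part of the stack do not depend on what is above. -/
theorem InStep.lift {p q : S} {x x' b b' : List G} (h : M.InStep (p, x, b) (q, x', b')) (Y : G)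
    (u : List G) : M.Move (p, x ++ Y :: u, b) (q, x' ++ Y :: u, b') := by
  cases h with
  | look x b h =>
    cases x with
    | nil => exact (Step.look Y u b h).move
    | cons X x => exact (Step.look X (x ++ Y :: u) b h).move
  | up Z X x b h => exact (Step.up Z X (x' ++ Y :: u) b h).move
  | down Z X x b h => exact (Step.down Z X (x ++ Y :: u) b h).move

theorem lift_inner {c c' : S × List G × List G} (h : Relation.ReflTransGen M.InStep c c') (Y : G)
    (u : List G) : Relation.ReflTransGen M.Move (c.1, c.2.1 ++ Y :: u, c.2.2)
      (c'.1, c'.2.1 ++ Y :: u, c'.2.2) := by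
  induction h with
  | refl => exact .refl
  | tail _ h ih => exact .tail ih (h.lift Y u)

theorem InStep.lift_in {p q : S} {x x' b b' : List G} (h : M.InStep (p, x, b) (q, x', b'))
    (u : List G) : M.InStep (p, x ++ u, b) (q, x' ++ u, b') := by
  cases h with
  | look x b h => exact .look _ b h
  | up Z X x b h => exact .up Z X (x' ++ u) b h
  | down Z X x b h => exact .down Z X (x ++ u) b h

theorem lift_in {c c' : S × List G × List G} (h : Relation.ReflTransGen M.InStep c c')
    (u : List G) : Relation.ReflTransGen M.InStep (c.1, c.2.1 ++ u, c.2.2)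
      (c'.1, c'.2.1 ++ u, c'.2.2) := by
  induction h with
  | refl => exact .refl
  | tail _ h ih => exact .tail ih (h.lift_in u)

end ElemMachine

/-! ### Stack types: what a computation can notice of a lower part of the stack -/

namespace ElemMachine

variable {S G A : Type*} {M : ElemMachine S G A}

/-- A computation inside `Z :: b` alternates between `look` moves at `Z` and excursions into `b`
that begin and end on the top cell of `b`. An excursion is an instance of `Inner`, so it can be
exchanged for one into `b'`. The second conjunct is the induction invariant in the middle of an
excursion: the computation must still come out of `b`, and the part after that has already been
transferred. -/
theorem inner_cons_aux {b b' : List G} (hI : M.Inner b = M.Inner b') (hh : b.head? = b'.head?)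
    (Z : G) (r : S) {c : S × List G × List G}
    (h : Relation.ReflTransGen M.InStep c (r, [], Z :: b)) :
    (∀ p, c = (p, [], Z :: b) → M.Inner (Z :: b') p r) ∧
    ∀ p x y, c = (p, x ++ [Z], y) → x.reverse ++ y = b →
      ∃ p₁ q, Relation.ReflTransGen M.InStep (p, x, y) (p₁, [], b) ∧ M.up p₁ q ∧
        M.Inner (Z :: b') q r := by
  induction h using Relation.ReflTransGen.head_induction_on with
  | refl =>
    refine ⟨fun p hp => ?_, fun p x y hp _ => ?_⟩
    · cases hp; exact .refl
    · simp at hp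
  | @head c c₁ hs _ ih =>
    obtain ⟨ih₁, ih₂⟩ := ih
    constructor
    · rintro p rfl
      cases hs with
      | look _ _ hl => exact .head (.look _ _ hl) (ih₁ _ rfl)
      | down Y _ _ b₀ hd =>
        obtain ⟨p₁, q, h₁, h₂, h₃⟩ := ih₂ _ [] _ rfl rfl
        obtain ⟨b₀', rfl⟩ : ∃ b₀', b' = Y :: b₀' := by
          cases b' with
          | nil => simp at hh
          | cons Y' b₀' => exact ⟨b₀', by simp at hh; rw [hh]⟩
        -- The excursion is complete here, so `hI` applies to it.
        have h₄ : M.Inner (Y :: b₀) _ p₁ := h₁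
        rw [hI] at h₄
        exact .head (.down Y Z [] b₀' hd) ((lift_in h₄ [Z]).trans (.head (.up Y Z [] b₀' h₂) h₃))
    · rintro p x y rfl hxy
      generalize hX : x ++ [Z] = X at hs
      cases hs with
      | look _ y hl =>
        obtain ⟨p₁, q, h₁, h₂⟩ := ih₂ _ x _ (by rw [hX]) hxy
        exact ⟨p₁, q, .head (.look _ _ hl) h₁, h₂⟩
      | up Z' Y u y hu =>
        cases x with
        | nil =>
          obtain ⟨rfl, rfl⟩ : Z = Y ∧ [] = u := by simpa using hX
          simp only [List.reverse_nil, List.nil_append] at hxy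
          subst hxy
          exact ⟨p, _, .refl, hu, ih₁ _ rfl⟩
        | cons X x =>
          simp only [List.cons_append, List.cons.injEq] at hX
          obtain ⟨rfl, rfl⟩ := hX
          obtain ⟨p₁, q, h₁, h₂⟩ := ih₂ _ x _ rfl (by simpa using hxy)
          exact ⟨p₁, q, .head (.up _ _ _ _ hu) h₁, h₂⟩
      | down Z' Y u y hd =>
        obtain ⟨p₁, q, h₁, h₂⟩ := ih₂ _ (Y :: x) _ (by rw [← hX]; rfl) (by simpa using hxy)
        exact ⟨p₁, q, .head (.down _ _ _ _ hd) h₁, h₂⟩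

theorem inner_cons {b b' : List G} (hI : M.Inner b = M.Inner b') (hh : b.head? = b'.head?)
    (Z : G) : M.Inner (Z :: b) = M.Inner (Z :: b') := by
  funext p q
  exact propext ⟨fun h => (inner_cons_aux hI hh Z q h).1 p rfl,
    fun h => (inner_cons_aux hI.symm hh.symm Z q h).1 p rfl⟩

/-- The same exchange of excursions for accepting computations on the full stack. They may also
remove everything above `b`; from then on `hA` takes over. No symbol of `b` can be rewritten before
that, since `top` and `pop` need the head at the top. -/
theorem coReach_aux {b b' : List G} (hI : M.Inner b = M.Inner b') (hh : b.head? = b'.head?)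
    (hA : ∀ p, M.CoReach (p, [], b) → M.CoReach (p, [], b')) {c : S × List G × List G}
    (h : M.CoReach c) :
    (∀ p u X x, c = (p, u, X :: x ++ b) → M.CoReach (p, u, X :: x ++ b')) ∧
    ∀ p x Y u y, c = (p, x ++ Y :: u, y) → x.reverse ++ y = b →
      ∃ p₁ q, Relation.ReflTransGen M.InStep (p, x, y) (p₁, [], b) ∧ M.up p₁ q ∧
        M.CoReach (q, u, Y :: b') := by
  induction h using Relation.ReflTransGen.head_induction_on with
  | refl => constructor <;> intros <;> simp_all
  | @head c c₁ hs hp ih =>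
    obtain ⟨k, a, hs⟩ := hs
    obtain ⟨ih₁, ih₂⟩ := ih
    constructor
    · rintro p u X x rfl
      generalize hX : X :: x ++ b = V at hs
      cases hs with
      | look Y u v hl =>
        simp only [List.cons_append, List.cons.injEq] at hX
        obtain ⟨rfl, rfl⟩ := hX
        exact .head (Step.look Y u (x ++ b') hl).move (ih₁ _ _ X x rfl)
      | @top _ q _ _ Y v ht =>
        simp only [List.cons_append, List.cons.injEq] at hX
        obtain ⟨rfl, rfl⟩ := hX
        exact .head (Step.top (x ++ b') ht).move (ih₁ _ _ Y x rfl)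
      | up Z Y u v hu =>
        simp only [List.cons_append, List.cons.injEq] at hX
        obtain ⟨rfl, rfl⟩ := hX
        exact .head (Step.up X Y u (x ++ b') hu).move (ih₁ _ _ Y (X :: x) rfl)
      | down Z Y u v hd =>
        simp only [List.cons_append, List.cons.injEq] at hX
        obtain ⟨rfl, hX⟩ := hX
        cases x with
        | cons X' x =>
          simp only [List.cons_append, List.cons.injEq] at hX
          obtain ⟨rfl, rfl⟩ := hX
          exact .head (Step.down X' X u (x ++ b') hd).move (ih₁ _ _ X' x rfl)
        | nil =>
          simp only [List.nil_append] at hX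
          subst hX
          obtain ⟨p₁, q, h₁, h₂, h₃⟩ := ih₂ _ [] X u _ rfl rfl
          obtain ⟨b₀, rfl⟩ : ∃ b₀, b' = Z :: b₀ := by
            cases b' with
            | nil => simp at hh
            | cons Y' b₀ => exact ⟨b₀, by simp at hh; rw [hh]⟩
          have h₄ : M.Inner (Z :: v) _ p₁ := h₁
          rw [hI] at h₄
          exact .head (Step.down Z X u b₀ hd).move
            ((lift_inner h₄ X u).trans (.head (Step.up Z X u b₀ h₂).move h₃))
      | @push _ q X' v hu =>
        subst hX
        exact .head (Step.push (X :: x ++ b') hu).move (ih₁ _ _ X' (X :: x) rfl)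
      | pop v hu =>
        simp only [List.cons_append, List.cons.injEq] at hX
        obtain ⟨rfl, rfl⟩ := hX
        -- If the last symbol above `b` is popped, `b` itself becomes the whole stack and `hA`
        -- replaces the induction hypothesis.
        refine .head (Step.pop (x ++ b') hu).move ?_
        cases x with
        | nil => exact hA _ hp
        | cons X' x => exact ih₁ _ _ X' x rfl
    · rintro p x Y u y rfl hxy
      generalize hX : x ++ Y :: u = V at hs
      cases hs with
      | look Y' u' y hl =>
        obtain ⟨p₁, q, h₁, h₂⟩ := ih₂ _ x Y u _ (by rw [hX]) hxy
        exact ⟨p₁, q, .head (.look _ _ hl) h₁, h₂⟩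
      | top y ht => simp at hX
      | push y ht => simp at hX
      | pop y ht => simp at hX
      | up Z' Y' u' y hu =>
        cases x with
        | nil =>
          obtain ⟨rfl, rfl⟩ : Y = Y' ∧ u = u' := by simpa using hX
          simp only [List.reverse_nil, List.nil_append] at hxy
          subst hxy
          exact ⟨p, _, .refl, hu, ih₁ _ _ Y [] rfl⟩
        | cons X x =>
          simp only [List.cons_append, List.cons.injEq] at hX
          obtain ⟨rfl, rfl⟩ := hX
          obtain ⟨p₁, q, h₁, h₂⟩ := ih₂ _ x Y u _ rfl (by simpa using hxy)
          exact ⟨p₁, q, .head (.up _ _ _ _ hu) h₁, h₂⟩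
      | down Z' Y' u' y hd =>
        obtain ⟨p₁, q, h₁, h₂⟩ := ih₂ _ (Y' :: x) Y u _ (by rw [← hX]; rfl) (by simpa using hxy)
        exact ⟨p₁, q, .head (.down _ _ _ _ hd) h₁, h₂⟩

/-- What the rest of a computation can notice of the part `b` of the stack. -/
def stackType (M : ElemMachine S G A) (b : List G) :
    Option G × (S → S → Prop) × (S → Prop) × (S → Prop) :=
  (b.head?, M.Inner b, (fun p => M.CoReach (p, [], b)), fun p => M.Reach (p, [], b))

theorem head?_eq_of_stackType_eq {b b' : List G} (h : M.stackType b = M.stackType b') :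
    b.head? = b'.head? := congrArg Prod.fst h

theorem inner_eq_of_stackType_eq {b b' : List G} (h : M.stackType b = M.stackType b') :
    M.Inner b = M.Inner b' := congrArg (fun t => t.2.1) h

theorem coReach_iff_of_stackType_eq {b b' : List G} (h : M.stackType b = M.stackType b') (p : S) :
    M.CoReach (p, [], b) ↔ M.CoReach (p, [], b') :=
  iff_of_eq (congrFun (congrArg (fun t => t.2.2.1) h) p)

theorem reach_iff_of_stackType_eq {b b' : List G} (h : M.stackType b = M.stackType b') (p : S) :
    M.Reach (p, [], b) ↔ M.Reach (p, [], b') :=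
  iff_of_eq (congrFun (congrArg (fun t => t.2.2.2) h) p)

/-- The type is symmetric in time: reversal transposes `Inner` and exchanges `Reach` with `CoReach`.
Every statement on `CoReach` therefore yields one on `Reach`. -/
theorem stackType_rev {b b' : List G} (h : M.stackType b = M.stackType b') :
    M.rev.stackType b = M.rev.stackType b' := by
  have h₁ := inner_eq_of_stackType_eq h
  simp only [stackType, Prod.mk.injEq]
  refine ⟨head?_eq_of_stackType_eq h, ?_, ?_, ?_⟩
  · funext p q
    rw [inner_rev, inner_rev, h₁]
  · funext p
    rw [coReach_rev, coReach_rev, reach_iff_of_stackType_eq h]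
  · funext p
    rw [reach_rev, reach_rev, coReach_iff_of_stackType_eq h]

theorem coReach_cons_iff {b b' : List G} (h : M.stackType b = M.stackType b') (p : S) (u : List G)
    (X : G) (x : List G) : M.CoReach (p, u, X :: x ++ b) ↔ M.CoReach (p, u, X :: x ++ b') :=
  ⟨fun hc => (coReach_aux (inner_eq_of_stackType_eq h) (head?_eq_of_stackType_eq h)
      (fun p => (coReach_iff_of_stackType_eq h p).1) hc).1 p u X x rfl,
    fun hc => (coReach_aux (inner_eq_of_stackType_eq h).symm (head?_eq_of_stackType_eq h).symm
      (fun p => (coReach_iff_of_stackType_eq h p).2) hc).1 p u X x rfl⟩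

theorem reach_cons_iff {b b' : List G} (h : M.stackType b = M.stackType b') (p : S) (u : List G)
    (X : G) (x : List G) : M.Reach (p, u, X :: x ++ b) ↔ M.Reach (p, u, X :: x ++ b') := by
  rw [← coReach_rev, ← coReach_rev]
  exact coReach_cons_iff (stackType_rev h) p u X x

/-- The type of a stack determines the types of the stacks obtained by pushing. -/
theorem stackType_cons {b b' : List G} (h : M.stackType b = M.stackType b') (Z : G) :
    M.stackType (Z :: b) = M.stackType (Z :: b') := by
  simp only [stackType, Prod.mk.injEq]
  refine ⟨rfl, inner_cons (inner_eq_of_stackType_eq h) (head?_eq_of_stackType_eq h) Z, ?_, ?_⟩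
  · funext p
    exact propext (coReach_cons_iff h p [] Z [])
  · funext p
    exact propext (reach_cons_iff h p [] Z [])

/-- The first time an accepting computation leaves the part `b` of the stack. -/
theorem CoReach.exists_exit {p : S} {Y : G} {u b : List G} (h : M.CoReach (p, Y :: u, b)) :
    ∃ p₁ q, M.Inner b p p₁ ∧ M.up p₁ q ∧ M.CoReach (q, u, Y :: b) :=
  (coReach_aux rfl rfl (fun _ h => h) h).2 p [] Y u b rfl rfl

/-- The last time a computation enters the part `b` of the stack. -/
theorem Reach.exists_enter {p : S} {Y : G} {u b : List G} (h : M.Reach (p, Y :: u, b)) :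
    ∃ q p₁, M.Reach (q, u, Y :: b) ∧ M.down q p₁ ∧ M.Inner b p₁ p := by
  obtain ⟨p₁, q, h₁, h₂, h₃⟩ := (coReach_rev.2 h).exists_exit
  exact ⟨q, p₁, coReach_rev.1 h₃, h₂, inner_rev.1 h₁⟩

/-- With symbols above `b` an accepting computation has to leave `b`. Up to the first exit it is
described by `Inner`; afterwards the head is above `b` and `coReach_cons_iff` applies. -/
theorem coReach_below_iff {b b' : List G} (h : M.stackType b = M.stackType b') (p : S)
    (Y : G) (u : List G) : M.CoReach (p, Y :: u, b) ↔ M.CoReach (p, Y :: u, b') := by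
  suffices H : ∀ {b b'}, M.stackType b = M.stackType b' → M.CoReach (p, Y :: u, b) →
      M.CoReach (p, Y :: u, b') from ⟨H h, H h.symm⟩
  intro b b' h hc
  by_cases hb : b' = []
  · have hh := head?_eq_of_stackType_eq h
    subst hb
    cases b with
    | nil => exact hc
    | cons Z b => simp at hh
  obtain ⟨Z, b', rfl⟩ := List.exists_cons_of_ne_nil hb
  obtain ⟨p₁, q, h₁, h₂, h₃⟩ := hc.exists_exit
  have h₄ : M.Inner (Z :: b') p p₁ := inner_eq_of_stackType_eq h ▸ h₁
  exact (lift_inner h₄ Y u).trans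
    (.head (Step.up Z Y u b' h₂).move ((coReach_cons_iff h q u Y []).1 h₃))

theorem reach_below_iff {b b' : List G} (h : M.stackType b = M.stackType b') (p : S)
    (Y : G) (u : List G) : M.Reach (p, Y :: u, b) ↔ M.Reach (p, Y :: u, b') := by
  rw [← coReach_rev, ← coReach_rev]
  exact coReach_below_iff (stackType_rev h) p Y u

end ElemMachine

/-! ### A pumping bound for shortest missing words -/

/-- If membership in `L` of nonempty words is determined by a map to a finite type that is
compatible with appending letters, then a shortest word outside `L` is short. -/
theorem exists_notMem_length_le {A X : Type*} [Finite X] (φ : List A → X) (L : Set (List A))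
    (hL : ∀ v w, v ≠ [] → w ≠ [] → φ v = φ w → v ∈ L → w ∈ L)
    (hφ : ∀ v w a, φ v = φ w → φ (v ++ [a]) = φ (w ++ [a])) {w : List A} (hw : w ∉ L) :
    ∃ w ∉ L, w.length ≤ Nat.card X := by
  have := Fintype.ofFinite X
  rw [Nat.card_eq_fintype_card]
  induction hn : w.length using Nat.strong_induction_on generalizing w with
  | _ n ih =>
    by_cases hle : n ≤ Fintype.card X
    · exact ⟨w, hw, hn ▸ hle⟩
    -- Only nonempty prefixes are compared, so that cutting out the part between them leaves a
    -- nonempty word, as `hL` requires.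
    obtain ⟨i, j, hij, hne⟩ : ∃ i j : Fin n, φ (w.take (i + 1)) = φ (w.take (j + 1)) ∧ i < j := by
      obtain ⟨i, j, hne, hij⟩ := Fintype.exists_ne_map_eq_of_card_lt
        (fun i : Fin n => φ (w.take (i + 1))) (by simpa using hle)
      rcases lt_or_gt_of_ne hne with h | h
      · exact ⟨i, j, hij, h⟩
      · exact ⟨j, i, hij.symm, h⟩
    have happ : ∀ z v v', φ v = φ v' → φ (v ++ z) = φ (v' ++ z) := by
      intro z
      induction z with
      | nil => intro v v' h; simpa using h
      | cons a z ihz =>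
        intro v v' h
        have := ihz _ _ (hφ v v' a h)
        simpa using this
    have h₁ := happ (w.drop (j + 1)) _ _ hij
    rw [List.take_append_drop] at h₁
    have hi := i.2
    have hj := j.2
    have hlt : (i : ℕ) < j := hne
    have hlen : (w.take (i + 1) ++ w.drop (j + 1)).length = i + 1 + (n - (j + 1)) := by
      simp only [List.length_append, List.length_take, List.length_drop]; omega
    refine ih (i + 1 + (n - (j + 1))) (by omega) (fun hmem => hw ?_) hlen
    refine hL _ _ ?_ ?_ h₁ hmem
    · intro h0; rw [h0] at hlen; simp at hlen; omega
    · intro h0; rw [h0] at hn; simp at hn; omega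

/-! ### Right-invariants for pushing and for upward segments -/

namespace ElemMachine

variable {S G A : Type*} {M : ElemMachine S G A}

/-- State `p` with stack `b`, the head at the top, is reachable such that `w` is read in a final
segment that only rewrites the top symbol and pushes. -/
inductive PushReach (M : ElemMachine S G A) : S → List G → List A → Prop where
  | base {p : S} {b : List G} : M.Reach (p, [], b) → PushReach M p b []
  | top {p q : S} {a : Option A} {Z Y : G} {b : List G} {w : List A} :
      PushReach M p (Z :: b) w → M.top p a Z Y q → PushReach M q (Y :: b) (w ++ a.toList)
  | push {p q : S} {X : G} {b : List G} {w : List A} :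
      PushReach M p b w → M.push p X q → PushReach M q (X :: b) w

/-- Nonemptiness forces at least one move of kind 1 or 4, which puts the head at the top. The empty
word could be read with the head anywhere. -/
theorem mem_segmentLang_push {w : List A} (hw : w ≠ []) :
    w ∈ M.segmentLang {1, 4} ↔ ∃ p b, M.PushReach p b w ∧ M.CoReach (p, [], b) := by
  constructor
  · rintro ⟨c, c', h₁, h₂, h₃⟩
    suffices H : w = [] ∧ c = c' ∨ ∃ p b, c' = (p, [], b) ∧ M.PushReach p b w by
      rcases H with ⟨h, -⟩ | ⟨p, b, rfl, h⟩
      · exact absurd h hw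
      · exact ⟨p, b, h, h₃⟩
    clear h₃ hw
    induction h₂ using LabelledPath.snoc_induction with
    | hrefl => exact .inl ⟨rfl, rfl⟩
    | hsnoc _ hk hs ih =>
      right
      rcases ih with ⟨rfl, rfl⟩ | ⟨p, b, rfl, ih⟩
      · cases hs with
        | top b ht => exact ⟨_, _, rfl, .top (.base h₁) ht⟩
        | push b ht => exact ⟨_, _, rfl, by simpa using PushReach.push (.base h₁) ht⟩
        | _ => simp at hk
      · cases hs with
        | top b ht => exact ⟨_, _, rfl, .top ih ht⟩
        | push b ht => exact ⟨_, _, rfl, by simpa using PushReach.push ih ht⟩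
        | _ => simp at hk
  · rintro ⟨p, b, h₁, h₂⟩
    suffices H : ∃ c, M.Reach c ∧ LabelledPath M.Step {1, 4} c w (p, [], b) by
      obtain ⟨c, h₃, h₄⟩ := H
      exact ⟨c, _, h₃, h₄, h₂⟩
    clear h₂ hw
    induction h₁ with
    | base h => exact ⟨_, h, .refl _⟩
    | top _ ht ih =>
      obtain ⟨c, h₃, h₄⟩ := ih
      exact ⟨c, h₃, h₄.snoc (by simp) (.top _ ht)⟩
    | push _ ht ih =>
      obtain ⟨c, h₃, h₄⟩ := ih
      exact ⟨c, h₃, by simpa using h₄.snoc (by simp) (.push _ ht)⟩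

/-- The types of the configurations in which a pushing segment may have read `w`. -/
def pushTypes (M : ElemMachine S G A) (w : List A) :
    Set (S × Option G × Option G × (S → S → Prop) × (S → Prop) × (S → Prop)) :=
  {t | ∃ p b, M.PushReach p b w ∧ t = (p, b.head?, M.stackType b.tail)}

/-- The top symbol and the type below it are a finer invariant than the type of the whole stack.
`pushTypes` needs the finer one because `top` replaces the top symbol, and the type of `Z :: b` need
not determine that of `Y :: b`. -/
theorem stackType_eq_of_tail {b b' : List G} (hh : b.head? = b'.head?)
    (ht : M.stackType b.tail = M.stackType b'.tail) : M.stackType b = M.stackType b' := by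
  cases b with
  | nil => cases b' with
    | nil => rfl
    | cons Z b' => simp at hh
  | cons Z b => cases b' with
    | nil => simp at hh
    | cons Z' b' =>
      obtain rfl : Z = Z' := by simpa using hh
      exact stackType_cons ht Z

/-- Let the last letter be read by a `top` move. The situation just before it occurs, up to type,
for `w` as well; the move and the silent moves after it can be repeated there because they depend
only on the type and preserve equality of types. -/
theorem pushTypes_append_subset {v w : List A} (h : M.pushTypes v = M.pushTypes w) (a : A) :
    M.pushTypes (v ++ [a]) ⊆ M.pushTypes (w ++ [a]) := by
  rintro _ ⟨p, b, hp, rfl⟩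
  generalize hz : v ++ [a] = z at hp
  induction hp with
  | base => simp at hz
  | @top p q a' Z Y b z hp ht ih =>
    cases a' with
    | none =>
      obtain ⟨p', b', h₁, h₂⟩ := ih (by simpa using hz)
      simp only [Prod.mk.injEq, List.head?_cons, List.tail_cons] at h₂
      obtain ⟨rfl, h₃, h₄⟩ := h₂
      cases b' with
      | nil => simp at h₃
      | cons Z' b' =>
        obtain rfl : Z = Z' := by simpa using h₃
        exact ⟨q, Y :: b', by simpa using PushReach.top h₁ ht, by simpa using h₄⟩
    | some a' =>
      obtain ⟨rfl, rfl⟩ : v = z ∧ a = a' := by simpa using List.append_inj' hz rfl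
      have : (p, (Z :: b).head?, M.stackType (Z :: b).tail) ∈ M.pushTypes v := ⟨p, _, hp, rfl⟩
      rw [h] at this
      obtain ⟨p', b', h₁, h₂⟩ := this
      simp only [Prod.mk.injEq, List.head?_cons, List.tail_cons] at h₂
      obtain ⟨rfl, h₃, h₄⟩ := h₂
      cases b' with
      | nil => simp at h₃
      | cons Z' b' =>
        obtain rfl : Z = Z' := by simpa using h₃
        exact ⟨q, Y :: b', by simpa using PushReach.top h₁ ht, by simpa using h₄⟩
  | @push p q X b z hp ht ih =>
    obtain ⟨p', b', h₁, h₂⟩ := ih hz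
    simp only [Prod.mk.injEq] at h₂
    obtain ⟨rfl, h₃, h₄⟩ := h₂
    refine ⟨q, X :: b', .push h₁ ht, ?_⟩
    simp only [List.head?_cons, List.tail_cons, Prod.mk.injEq, true_and]
    exact stackType_eq_of_tail h₃ h₄

theorem mem_push_of_pushTypes_eq {v w : List A} (hv : v ≠ []) (hw : w ≠ [])
    (h : M.pushTypes v = M.pushTypes w) (hm : v ∈ M.segmentLang {1, 4}) :
    w ∈ M.segmentLang {1, 4} := by
  obtain ⟨p, b, h₁, h₂⟩ := (mem_segmentLang_push hv).1 hm
  have : (p, b.head?, M.stackType b.tail) ∈ M.pushTypes v := ⟨p, b, h₁, rfl⟩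
  rw [h] at this
  obtain ⟨p', b', h₃, h₄⟩ := this
  simp only [Prod.mk.injEq] at h₄
  obtain ⟨rfl, h₅, h₆⟩ := h₄
  exact (mem_segmentLang_push hw).2
    ⟨p, b', h₃, (coReach_iff_of_stackType_eq (stackType_eq_of_tail h₅ h₆) p).1 h₂⟩

/-- `M.Climb r q b w`: from a configuration that `M` can reach when it enters `b` from above in
state `r` and goes down, `w` is read while the head moves up to the top of `b`, in state `q`. -/
inductive Climb (M : ElemMachine S G A) : S → S → List G → List A → Prop where
  | base (r : S) (b : List G) : Climb M r r b []
  | look {r p q : S} {a : Option A} {Z : G} {b : List G} {w : List A} :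
      Climb M r p (Z :: b) w → M.look p a Z q → Climb M r q (Z :: b) (w ++ a.toList)
  | up {r r₁ r₂ p q : S} {Z Y : G} {b : List G} {w : List A} :
      Climb M r p (Z :: b) w → M.up p q → M.down r₁ r₂ → M.Inner (Z :: b) r₂ r →
      Climb M r₁ q (Y :: Z :: b) w

/-- The symbols above the head are unknown while the head climbs, so reachability of the start of
the segment is postponed: it is expressed by `r`, a condition on the symbols above `b` that is
discharged at the end. Unfolding one `up` of the climb adds the corresponding entrance to the
reaching computation. -/
theorem Climb.exists_path {r q : S} {b : List G} {w : List A} (h : M.Climb r q b w) :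
    ∀ Y u, M.Reach (r, Y :: u, b) →
      ∃ c, M.Reach c ∧ LabelledPath M.Step {0, 2} c w (q, Y :: u, b) := by
  induction h with
  | base r b => exact fun Y u h => ⟨_, h, .refl _⟩
  | look _ hl ih =>
    intro Y u h
    obtain ⟨c, h₁, h₂⟩ := ih Y u h
    exact ⟨c, h₁, h₂.snoc (by simp) (.look _ _ _ hl)⟩
  | @up r r₁ r₂ p q Z X b w _ hu hd hI ih =>
    intro Y u h
    obtain ⟨c, h₁, h₂⟩ := ih X (Y :: u)
      ((h.tail (Step.down Z X (Y :: u) b hd).move).trans (lift_inner hI X (Y :: u)))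
    exact ⟨c, h₁, by simpa using h₂.snoc (by simp) (.up _ _ _ _ hu)⟩

/-- At each `up` move the last entrance of the reaching computation into the part being left
supplies the `down` move and the `Inner` relation in the constructor. -/
theorem exists_climb {c c' : S × List G × List G} {w : List A} (hc : M.Reach c)
    (h : LabelledPath M.Step {0, 2} c w c') :
    ∃ r, M.Reach (r, c'.2.1, c'.2.2) ∧ M.Climb r c'.1 c'.2.2 w := by
  induction h using LabelledPath.snoc_induction with
  | hrefl => exact ⟨c.1, hc, .base _ _⟩
  | hsnoc _ hk hs ih =>
    obtain ⟨r, h₁, h₂⟩ := ih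
    cases hs with
    | look Y u b hl => exact ⟨r, h₁, .look h₂ hl⟩
    | up Z Y u b hu =>
      obtain ⟨q, p₁, h₃, h₄, h₅⟩ := Reach.exists_enter h₁
      exact ⟨q, h₃, by simpa using Climb.up h₂ hu h₄ h₅⟩
    | _ => simp at hk

theorem mem_segmentLang_up {w : List A} (hw : w ≠ []) :
    w ∈ M.segmentLang {0, 2} ↔ ∃ r q b Y u, M.Climb r q b w ∧ M.Reach (r, Y :: u, b) ∧
      M.CoReach (q, Y :: u, b) := by
  constructor
  · rintro ⟨c, c', h₁, h₂, h₃⟩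
    -- If the last move is `up`, it may end at the top of the stack. It reads nothing, so it is
    -- moved to the accepting remainder; the segment then ends with a symbol above the head.
    obtain ⟨c', Y, u, h₂, h₃, h₄⟩ : ∃ c' Y u, LabelledPath M.Step {0, 2} c w c' ∧ M.CoReach c' ∧
        c'.2.1 = Y :: u := by
      induction h₂ using LabelledPath.snoc_induction with
      | hrefl => simp at hw
      | hsnoc hp hk hs ih =>
        cases hs with
        | look Y u b hl => exact ⟨_, Y, u, hp.snoc hk (.look Y u b hl), h₃, rfl⟩
        | up Z Y u b hu => exact ⟨_, Y, u, by simpa using hp,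
            .head (Step.up Z Y u b hu).move h₃, rfl⟩
        | _ => simp at hk
    obtain ⟨r, h₅, h₆⟩ := exists_climb h₁ h₂
    obtain ⟨q, x, b⟩ := c'
    obtain rfl : x = Y :: u := h₄
    exact ⟨r, q, b, Y, u, h₆, h₅, h₃⟩
  · rintro ⟨r, q, b, Y, u, h₁, h₂, h₃⟩
    obtain ⟨c, h₄, h₅⟩ := h₁.exists_path Y u h₂
    exact ⟨c, _, h₄, h₅, h₃⟩

/-- The types of the configurations in which an upward segment may have read `w`. -/
def climbTypes (M : ElemMachine S G A) (w : List A) :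
    Set (S × S × Option G × (S → S → Prop) × (S → Prop) × (S → Prop)) :=
  {t | ∃ r q b, M.Climb r q b w ∧ t = (r, q, M.stackType b)}

/-- A `look` depends only on the head symbol and an `up` only on `Inner` of the part below, and both
are components of the type. The type after `up` is then determined by `stackType_cons`, whatever
symbol `Y` the head meets. -/
theorem climbTypes_append_subset {v w : List A} (h : M.climbTypes v = M.climbTypes w) (a : A) :
    M.climbTypes (v ++ [a]) ⊆ M.climbTypes (w ++ [a]) := by
  rintro _ ⟨r, q, b, hc, rfl⟩
  generalize hz : v ++ [a] = z at hc
  have key : ∀ {Z : G} {b b' : List G}, M.stackType (Z :: b) = M.stackType b' →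
      ∃ b₀, b' = Z :: b₀ := by
    intro Z b b' hb
    have hh := head?_eq_of_stackType_eq hb
    cases b' with
    | nil => simp at hh
    | cons Z' b₀ => exact ⟨b₀, by simp at hh; rw [hh]⟩
  induction hc with
  | base => simp at hz
  | @look r p q a' Z b z hc hl ih =>
    cases a' with
    | none =>
      obtain ⟨r', p', b', h₁, h₂⟩ := ih (by simpa using hz)
      simp only [Prod.mk.injEq] at h₂
      obtain ⟨rfl, rfl, h₃⟩ := h₂
      obtain ⟨b₀, rfl⟩ := key h₃
      exact ⟨r, q, _, by simpa using Climb.look h₁ hl, by rw [h₃]⟩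
    | some a' =>
      obtain ⟨rfl, rfl⟩ : v = z ∧ a = a' := by simpa using List.append_inj' hz rfl
      have : (r, p, M.stackType (Z :: b)) ∈ M.climbTypes v := ⟨r, p, _, hc, rfl⟩
      rw [h] at this
      obtain ⟨r', p', b', h₁, h₂⟩ := this
      simp only [Prod.mk.injEq] at h₂
      obtain ⟨rfl, rfl, h₃⟩ := h₂
      obtain ⟨b₀, rfl⟩ := key h₃
      exact ⟨r, q, _, by simpa using Climb.look h₁ hl, by rw [h₃]⟩
  | @up r r₁ r₂ p q Z Y b z hc hu hd hI ih =>
    obtain ⟨r', p', b', h₁, h₂⟩ := ih hz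
    simp only [Prod.mk.injEq] at h₂
    obtain ⟨rfl, rfl, h₃⟩ := h₂
    obtain ⟨b₀, rfl⟩ := key h₃
    rw [inner_eq_of_stackType_eq h₃] at hI
    exact ⟨r₁, q, _, .up (Y := Y) h₁ hu hd hI, by rw [stackType_cons h₃]⟩

theorem mem_up_of_climbTypes_eq {v w : List A} (hv : v ≠ []) (hw : w ≠ [])
    (h : M.climbTypes v = M.climbTypes w) (hm : v ∈ M.segmentLang {0, 2}) :
    w ∈ M.segmentLang {0, 2} := by
  obtain ⟨r, q, b, Y, u, h₁, h₂, h₃⟩ := (mem_segmentLang_up hv).1 hm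
  have : (r, q, M.stackType b) ∈ M.climbTypes v := ⟨r, q, b, h₁, rfl⟩
  rw [h] at this
  obtain ⟨r', q', b', h₄, h₅⟩ := this
  simp only [Prod.mk.injEq] at h₅
  obtain ⟨rfl, rfl, h₆⟩ := h₅
  exact (mem_segmentLang_up hw).2 ⟨r, q, b', Y, u, h₄, (reach_below_iff h₆ r Y u).1 h₂,
    (coReach_below_iff h₆ q Y u).1 h₃⟩

/-- A bound for the shortest word outside a segment language. -/
def witnessBound (n m : ℕ) : ℕ :=
  2 ^ (n * ((n + (m + 1)) * ((m + 1) * (2 ^ (n * n) * (2 ^ n * 2 ^ n)))))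

theorem witnessBound_mono {n n' m m' : ℕ} (hn : n ≤ n') (hm : m ≤ m') :
    witnessBound n m ≤ witnessBound n' m' := by
  unfold witnessBound
  gcongr <;> norm_num

variable {B : Type*}

theorem exists_short_push [Finite S] [Finite G] (f : B → A) {w : List B}
    (hw : w.map f ∉ M.segmentLang {1, 4}) :
    ∃ w : List B, w.map f ∉ M.segmentLang {1, 4} ∧
      w.length ≤ witnessBound (Nat.card S) (Nat.card G) := by
  obtain ⟨w, h₁, h₂⟩ := exists_notMem_length_le (fun w => M.pushTypes (w.map f))
    {w : List B | w.map f ∈ M.segmentLang {1, 4}}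
    (fun v w hv hw h hm => mem_push_of_pushTypes_eq (by simpa using hv) (by simpa using hw) h hm)
    (fun v w a h => by
      simp only [List.map_append, List.map_cons, List.map_nil]
      exact (pushTypes_append_subset h _).antisymm (pushTypes_append_subset h.symm _)) hw
  refine ⟨w, h₁, h₂.trans ?_⟩
  have := Fintype.ofFinite S
  have := Fintype.ofFinite G
  classical
  simp only [Nat.card_eq_fintype_card, Fintype.card_set, Fintype.card_prod, Fintype.card_option,
    Fintype.card_fun, Fintype.card_prop, ← pow_mul, witnessBound]
  -- In the factor `n + (m + 1)` of `witnessBound` the summand `m + 1` counts the top symbols of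
  -- `pushTypes`; the summand `n` counts the states `r` of `climbTypes`.
  exact Nat.pow_le_pow_right two_pos
    (Nat.mul_le_mul_left _ (Nat.mul_le_mul_right _ (Nat.le_add_left _ _)))

theorem exists_short_up [Finite S] [Finite G] (f : B → A) {w : List B}
    (hw : w.map f ∉ M.segmentLang {0, 2}) :
    ∃ w : List B, w.map f ∉ M.segmentLang {0, 2} ∧
      w.length ≤ witnessBound (Nat.card S) (Nat.card G) := by
  obtain ⟨w, h₁, h₂⟩ := exists_notMem_length_le (fun w => M.climbTypes (w.map f))
    {w : List B | w.map f ∈ M.segmentLang {0, 2}}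
    (fun v w hv hw h hm => mem_up_of_climbTypes_eq (by simpa using hv) (by simpa using hw) h hm)
    (fun v w a h => by
      simp only [List.map_append, List.map_cons, List.map_nil]
      exact (climbTypes_append_subset h _).antisymm (climbTypes_append_subset h.symm _)) hw
  refine ⟨w, h₁, h₂.trans ?_⟩
  have := Fintype.ofFinite S
  have := Fintype.ofFinite G
  classical
  simp only [Nat.card_eq_fintype_card, Fintype.card_set, Fintype.card_prod, Fintype.card_option,
    Fintype.card_fun, Fintype.card_prop, ← pow_mul, witnessBound]
  gcongr
  · norm_num
  · omega

/-- The four kinds of segments: with the head at the top, pushing or popping; with the head inside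
the stack, moving up or down. The first component is the kind of the moves that read. -/
def segmentModes : List (ℕ × ℕ) := [(1, 4), (1, 5), (0, 2), (0, 3)]

theorem exists_short_notMem_segmentLang [Finite S] [Finite G] (f : B → A) {m : ℕ × ℕ}
    (hm : m ∈ segmentModes) {w : List B} (hw : w.map f ∉ M.segmentLang {m.1, m.2}) :
    ∃ w : List B, w.map f ∉ M.segmentLang {m.1, m.2} ∧
      w.length ≤ witnessBound (Nat.card S) (Nat.card G) := by
  simp only [segmentModes, List.mem_cons, List.not_mem_nil, or_false] at hm
  rcases hm with rfl | rfl | rfl | rfl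
  · exact exists_short_push f hw
  · have H := fun w : List A => segmentLang_rev (M := M) (κ := {1, 5}) (κ' := {1, 4})
      (by simp [revKind]) (by simp [revKind]) w
    simp only [H] at hw ⊢
    rw [← List.map_reverse] at hw
    obtain ⟨w, h₁, h₂⟩ := exists_short_push f hw
    exact ⟨w.reverse, by simpa using h₁, by simpa using h₂⟩
  · exact exists_short_up f hw
  · have H := fun w : List A => segmentLang_rev (M := M) (κ := {0, 3}) (κ' := {0, 2})
      (by simp [revKind]) (by simp [revKind]) w
    simp only [H] at hw ⊢
    rw [← List.map_reverse] at hw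
    obtain ⟨w, h₁, h₂⟩ := exists_short_up f hw
    exact ⟨w.reverse, by simpa using h₁, by simpa using h₂⟩

end ElemMachine

/-! ### Machines given by instruction lists, and restriction to finitely many states and symbols -/

namespace ElemMachine

variable {S G A S' G' : Type*}

/-- The machine induced on other sets of states and stack symbols. -/
def comap (M : ElemMachine S G A) (f : S' → S) (g : G' → G) (start fin : S') :
    ElemMachine S' G' A where
  start := start
  fin := fin
  look p a Z q := M.look (f p) a (g Z) (f q)
  top p a Z Y q := M.top (f p) a (g Z) (g Y) (f q)
  up p q := M.up (f p) (f q)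
  down p q := M.down (f p) (f q)
  push p X q := M.push (f p) (g X) (f q)
  pop p X q := M.pop (f p) (g X) (f q)

/-- The states `f p` and symbols `g X` are closed under the moves of `M`. -/
structure IsClosedUnder (M : ElemMachine S G A) (f : S' → S) (g : G' → G) : Prop where
  look : ∀ {p a Z q}, M.look p a Z q → q ∈ Set.range f
  top : ∀ {p a Z Y q}, M.top p a Z Y q → Y ∈ Set.range g ∧ q ∈ Set.range f
  up : ∀ {p q}, M.up p q → q ∈ Set.range f
  down : ∀ {p q}, M.down p q → q ∈ Set.range f
  push : ∀ {p X q}, M.push p X q → X ∈ Set.range g ∧ q ∈ Set.range f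
  pop : ∀ {p X q}, M.pop p X q → q ∈ Set.range f

/-- Renaming states and stack symbols in a configuration. -/
def mapConfig (f : S' → S) (g : G' → G) (c : S' × List G' × List G') : S × List G × List G :=
  (f c.1, c.2.1.map g, c.2.2.map g)

section comap

variable {M : ElemMachine S G A} {f : S' → S} {g : G' → G} {start fin : S'}

theorem step_of_comap {k : ℕ} {a : Option A} {c c' : S' × List G' × List G'}
    (h : (M.comap f g start fin).Step k a c c') :
    M.Step k a (mapConfig f g c) (mapConfig f g c') := by
  cases h with
  | look Y u b h => exact .look _ _ _ h
  | top b h => exact .top _ h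
  | up Z Y u b h => exact .up _ _ _ _ h
  | down Z Y u b h => exact .down _ _ _ _ h
  | push b h => exact .push _ h
  | pop b h => exact .pop _ h

theorem IsClosedUnder.exists_step (hM : M.IsClosedUnder f g) {k : ℕ} {a : Option A}
    {c : S' × List G' × List G'} {d : S × List G × List G}
    (h : M.Step k a (mapConfig f g c) d) :
    ∃ c', d = mapConfig f g c' ∧ (M.comap f g start fin).Step k a c c' := by
  obtain ⟨p, u, b⟩ := c
  simp only [mapConfig] at h
  generalize hu : u.map g = u₁ at h
  generalize hb : b.map g = b₁ at h
  cases h with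
  | look Y u' b' h =>
    obtain ⟨Y, u, rfl, rfl, rfl⟩ := List.map_eq_cons_iff.1 hu
    obtain ⟨Z, b, rfl, rfl, rfl⟩ := List.map_eq_cons_iff.1 hb
    obtain ⟨q, rfl⟩ := hM.look h
    exact ⟨(q, Y :: u, Z :: b), rfl, .look _ _ _ h⟩
  | top b' h =>
    obtain rfl := List.map_eq_nil_iff.1 hu
    obtain ⟨Z, b, rfl, rfl, rfl⟩ := List.map_eq_cons_iff.1 hb
    obtain ⟨⟨Y, rfl⟩, q, rfl⟩ := hM.top h
    exact ⟨(q, [], Y :: b), rfl, .top _ h⟩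
  | up Z Y u' b' h =>
    obtain ⟨Y, u, rfl, rfl, rfl⟩ := List.map_eq_cons_iff.1 hu
    obtain ⟨Z, b, rfl, rfl, rfl⟩ := List.map_eq_cons_iff.1 hb
    obtain ⟨q, rfl⟩ := hM.up h
    exact ⟨(q, u, Y :: Z :: b), rfl, .up _ _ _ _ h⟩
  | down Z Y u' b' h =>
    obtain ⟨Y, b₂, rfl, rfl, hb₂⟩ := List.map_eq_cons_iff.1 hb
    obtain ⟨Z, b, rfl, rfl, rfl⟩ := List.map_eq_cons_iff.1 hb₂
    obtain ⟨q, rfl⟩ := hM.down h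
    subst hu
    exact ⟨(q, Y :: u, Z :: b), rfl, .down _ _ _ _ h⟩
  | push b' h =>
    obtain rfl := List.map_eq_nil_iff.1 hu
    obtain ⟨⟨X, rfl⟩, q, rfl⟩ := hM.push h
    subst hb
    exact ⟨(q, [], X :: b), rfl, .push _ h⟩
  | pop b' h =>
    obtain rfl := List.map_eq_nil_iff.1 hu
    obtain ⟨X, b, rfl, rfl, rfl⟩ := List.map_eq_cons_iff.1 hb
    obtain ⟨q, rfl⟩ := hM.pop h
    exact ⟨(q, [], b), rfl, .pop _ h⟩

theorem reflTransGen_of_comap {c c' : S' × List G' × List G'}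
    (h : Relation.ReflTransGen (M.comap f g start fin).Move c c') :
    Relation.ReflTransGen M.Move (mapConfig f g c) (mapConfig f g c') := by
  induction h with
  | refl => exact .refl
  | tail _ h ih =>
    obtain ⟨k, a, h⟩ := h
    exact ih.tail (step_of_comap h).move

theorem IsClosedUnder.exists_reflTransGen (hM : M.IsClosedUnder f g)
    {c : S' × List G' × List G'} {d : S × List G × List G}
    (h : Relation.ReflTransGen M.Move (mapConfig f g c) d) :
    ∃ c', d = mapConfig f g c' ∧ Relation.ReflTransGen (M.comap f g start fin).Move c c' := by
  induction h with
  | refl => exact ⟨c, rfl, .refl⟩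
  | tail _ h ih =>
    obtain ⟨c', rfl, ih⟩ := ih
    obtain ⟨k, a, h⟩ := h
    obtain ⟨c'', rfl, h⟩ := hM.exists_step h
    exact ⟨c'', rfl, ih.tail h.move⟩

theorem IsClosedUnder.exists_path (hM : M.IsClosedUnder f g) {κ : Set ℕ} {w : List A}
    {c₀ d : S × List G × List G} (h : LabelledPath M.Step κ c₀ w d) :
    ∀ c, c₀ = mapConfig f g c →
    ∃ c', d = mapConfig f g c' ∧ LabelledPath (M.comap f g start fin).Step κ c w c' := by
  induction h with
  | refl => exact fun c hc => ⟨c, hc, .refl c⟩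
  | cons hk hs _ ih =>
    rintro c rfl
    obtain ⟨c', rfl, hs⟩ := hM.exists_step hs
    obtain ⟨c'', rfl, h⟩ := ih c' rfl
    exact ⟨c'', rfl, .cons hk hs h⟩

theorem path_of_comap {κ : Set ℕ} {w : List A} {c c' : S' × List G' × List G'}
    (h : LabelledPath (M.comap f g start fin).Step κ c w c') :
    LabelledPath M.Step κ (mapConfig f g c) w (mapConfig f g c') := by
  induction h with
  | refl => exact .refl _
  | cons hk hs _ ih => exact .cons hk (step_of_comap hs) ih

theorem IsClosedUnder.coReach_iff (hM : M.IsClosedUnder f g) (hf : Function.Injective f)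
    (hfin : f fin = M.fin) (c : S' × List G' × List G') :
    (M.comap f g start fin).CoReach c ↔ M.CoReach (mapConfig f g c) := by
  constructor
  · intro h
    have := reflTransGen_of_comap h
    rwa [show mapConfig f g ((M.comap f g start fin).fin, [], []) = (M.fin, [], []) from by
      rw [← hfin]; rfl] at this
  · intro h
    obtain ⟨⟨p, u, b⟩, h₁, h₂⟩ := hM.exists_reflTransGen (start := start) (fin := fin) h
    simp only [mapConfig, Prod.mk.injEq] at h₁
    obtain ⟨h₃, h₄, h₅⟩ := h₁
    obtain rfl := List.map_eq_nil_iff.1 h₄.symm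
    obtain rfl := List.map_eq_nil_iff.1 h₅.symm
    obtain rfl : fin = p := hf (hfin.trans h₃)
    exact h₂

/-- Computations start with the empty stack, so by closure they never leave the given states and
symbols. -/
theorem IsClosedUnder.segmentLang_eq (hM : M.IsClosedUnder f g) (hf : Function.Injective f)
    (hstart : f start = M.start) (hfin : f fin = M.fin) (κ : Set ℕ) :
    (M.comap f g start fin).segmentLang κ = M.segmentLang κ := by
  have h0 : mapConfig f g (start, [], []) = (M.start, [], []) := by rw [← hstart]; rfl
  ext w
  constructor
  · rintro ⟨c, c', h₁, h₂, h₃⟩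
    refine ⟨_, _, ?_, path_of_comap h₂, (hM.coReach_iff hf hfin c').1 h₃⟩
    have := reflTransGen_of_comap h₁
    exact (congrArg (Relation.ReflTransGen M.Move · (mapConfig f g c)) h0).mp this
  · rintro ⟨d, d', h₁, h₂, h₃⟩
    rw [Reach, ← h0] at h₁
    obtain ⟨c, rfl, h₄⟩ := hM.exists_reflTransGen (start := start) (fin := fin) h₁
    obtain ⟨c', rfl, h₅⟩ := hM.exists_path (start := start) (fin := fin) h₂ c rfl
    exact ⟨c, c', h₄, h₅, (hM.coReach_iff hf hfin c').2 h₃⟩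

end comap

/-- An instruction: kind, source state, label, two stack symbols, target state. -/
abbrev Instr (S : Type*) := ℕ × S × Option ℕ × ℕ × ℕ × S

/-- The machine given by a list of instructions. -/
def ofList (L : List (Instr S)) (start fin : S) : ElemMachine S ℕ ℕ where
  start := start
  fin := fin
  look p a Z q := ∃ Y, (0, p, a, Z, Y, q) ∈ L
  top p a Z Y q := (1, p, a, Z, Y, q) ∈ L
  up p q := ∃ a Z Y, (2, p, a, Z, Y, q) ∈ L
  down p q := ∃ a Z Y, (3, p, a, Z, Y, q) ∈ L
  push p X q := ∃ a Z, (4, p, a, Z, X, q) ∈ L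
  pop p X q := ∃ a Y, (5, p, a, X, Y, q) ∈ L

/-- The states that matter to `ofList L start fin`. -/
def statesOf (L : List (Instr S)) (start fin : S) : List S :=
  start :: fin :: (L.map (fun e => e.2.1) ++ L.map (fun e => e.2.2.2.2.2))

/-- The stack symbols that `ofList L start fin` can write. -/
def symbolsOf (L : List (Instr S)) : List ℕ := L.map (fun e => e.2.2.2.2.1)

theorem src_mem_statesOf {L : List (Instr S)} {start fin : S} {e : Instr S} (h : e ∈ L) :
    e.2.1 ∈ statesOf L start fin := by
  simp only [statesOf, List.mem_cons, List.mem_append, List.mem_map]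
  exact .inr (.inr (.inl ⟨e, h, rfl⟩))

theorem dst_mem_statesOf {L : List (Instr S)} {start fin : S} {e : Instr S} (h : e ∈ L) :
    e.2.2.2.2.2 ∈ statesOf L start fin := by
  simp only [statesOf, List.mem_cons, List.mem_append, List.mem_map]
  exact .inr (.inr (.inr ⟨e, h, rfl⟩))

/-- `ofList L start fin` with the states and stack symbols that do not matter left out. -/
def restrictList (L : List (Instr S)) (start fin : S) :
    ElemMachine {p // p ∈ statesOf L start fin} {X // X ∈ symbolsOf L} ℕ :=
  (ofList L start fin).comap Subtype.val Subtype.val ⟨start, by simp [statesOf]⟩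
    ⟨fin, by simp [statesOf]⟩

theorem isClosedUnder_ofList (L : List (Instr S)) (start fin : S) :
    (ofList L start fin).IsClosedUnder (Subtype.val : {p // p ∈ statesOf L start fin} → S)
      (Subtype.val : {X // X ∈ symbolsOf L} → ℕ) := by
  have hd : ∀ {e : Instr S}, e ∈ L →
      e.2.2.2.2.2 ∈ Set.range (Subtype.val : {p // p ∈ statesOf L start fin} → S) :=
    fun h => ⟨⟨_, dst_mem_statesOf h⟩, rfl⟩
  have hs : ∀ {e : Instr S}, e ∈ L →
      e.2.2.2.2.1 ∈ Set.range (Subtype.val : {X // X ∈ symbolsOf L} → ℕ) :=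
    fun h => ⟨⟨_, List.mem_map_of_mem h⟩, rfl⟩
  constructor
  · rintro p a Z q ⟨Y, h⟩
    exact hd h
  · intro p a Z Y q h
    exact ⟨hs h, hd h⟩
  · rintro p q ⟨a, Z, Y, h⟩
    exact hd h
  · rintro p q ⟨a, Z, Y, h⟩
    exact hd h
  · rintro p X q ⟨a, Z, h⟩
    exact ⟨hs h, hd h⟩
  · rintro p X q ⟨a, Y, h⟩
    exact hd h

theorem card_mem_list_le {α : Type*} (l : List α) : Nat.card {x // x ∈ l} ≤ l.length := by
  classical
  have : Nat.card {x // x ∈ l} = l.toFinset.card := by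
    rw [← Fintype.card_coe, ← Nat.card_eq_fintype_card]
    exact Nat.card_congr (Equiv.subtypeEquivRight (by simp))
  exact this ▸ l.toFinset_card_le

theorem exists_short_notMem_ofList {B : Type*} (L : List (Instr S)) (start fin : S) (f : B → ℕ)
    {m : ℕ × ℕ} (hm : m ∈ segmentModes) {w : List B}
    (hw : w.map f ∉ (ofList L start fin).segmentLang {m.1, m.2}) :
    ∃ w : List B, w.map f ∉ (ofList L start fin).segmentLang {m.1, m.2} ∧
      w.length ≤ witnessBound (2 * L.length + 2) L.length := by
  have h := (isClosedUnder_ofList L start fin).segmentLang_eq Subtype.val_injective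
    (start := ⟨start, by simp [statesOf]⟩) (fin := ⟨fin, by simp [statesOf]⟩) rfl rfl {m.1, m.2}
  rw [← h] at hw ⊢
  have : Finite {p // p ∈ statesOf L start fin} := (List.finite_toSet _).to_subtype
  have : Finite {X // X ∈ symbolsOf L} := (List.finite_toSet _).to_subtype
  obtain ⟨w, h₁, h₂⟩ := exists_short_notMem_segmentLang f hm hw
  -- The relevant states are the start, the accepting state and the sources and targets of
  -- instructions, hence `2 * L.length + 2`; each instruction contributes one symbol.
  refine ⟨w, h₁, h₂.trans (witnessBound_mono ?_ ?_)⟩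
  · refine (card_mem_list_le _).trans ?_
    simp [statesOf]; omega
  · refine (card_mem_list_le _).trans ?_
    simp [symbolsOf]

/-! ### Finite tables that refute acceptance -/

/-- The conditions that an instruction `e` imposes on a table at a pushed symbol `r`. -/
def InstrClosed (rows : List (ℕ × ℕ × ℕ)) (T : List (ℕ × S × S)) (acc : List (ℕ × S))
    (e : Instr S) (r : ℕ × ℕ × ℕ) : Prop :=
  (e.1 = 0 → e.2.2.2.1 = r.2.1 → ∀ x ∈ T, x.1 = r.2.2 → x.2.1 = e.2.2.2.2.2 →
    (r.2.2, e.2.1, x.2.2) ∈ T) ∧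
  (e.1 = 1 → e.2.2.2.1 = r.2.1 → ∀ r' ∈ rows, r'.1 = r.1 → r'.2.1 = e.2.2.2.2.1 →
    (r'.2.2, e.2.2.2.2.2) ∈ acc → (r.2.2, e.2.1) ∈ acc) ∧
  (e.1 = 2 → (r.2.2, e.2.1, e.2.2.2.2.2) ∈ T) ∧
  (e.1 = 3 → ∀ x ∈ T, x.1 = r.1 → x.2.1 = e.2.2.2.2.2 →
    ((r.2.2, x.2.2) ∈ acc → (r.2.2, e.2.1) ∈ acc) ∧
    ∀ y ∈ T, y.1 = r.2.2 → y.2.1 = x.2.2 → (r.2.2, e.2.1, y.2.2) ∈ T) ∧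
  (e.1 = 4 → e.2.2.2.2.1 = r.2.1 → (r.2.2, e.2.2.2.2.2) ∈ acc → (r.1, e.2.1) ∈ acc) ∧
  (e.1 = 5 → e.2.2.2.1 = r.2.1 → (r.1, e.2.2.2.2.2) ∈ acc → (r.2.2, e.2.1) ∈ acc)

/-- Tables of an automaton that reads stacks: the number of the empty stack, the numbers of all
states, the transitions, the pairs of states between which the machine can pass on a stack of a
given type, and the states from which it can accept on such a stack. -/
abbrev Table (S : Type*) :=
  ℕ × List ℕ × List (ℕ × ℕ × ℕ) × List (ℕ × S × S) × List (ℕ × S)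

/-- The table shows that `ofList L start fin` has no accepting computation. -/
def Refutes (L : List (Instr S)) (start fin : S) (t : Table S) : Prop :=
  t.1 ∈ t.2.1 ∧ (t.1, fin) ∈ t.2.2.2.2 ∧ (t.1, start) ∉ t.2.2.2.2 ∧
  (∀ d ∈ t.2.1, ∀ e ∈ L, ∃ r ∈ t.2.2.1, r.1 = d ∧ r.2.1 = e.2.2.2.2.1) ∧
  (∀ r ∈ t.2.2.1, r.2.2 ∈ t.2.1) ∧
  ∀ e ∈ L, ∀ r ∈ t.2.2.1, InstrClosed t.2.2.1 t.2.2.2.1 t.2.2.2.2 e r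

/-- The numbers that a table assigns to a stack. -/
def Assigned (d₀ : ℕ) (rows : List (ℕ × ℕ × ℕ)) : List ℕ → ℕ → Prop
  | [], d => d = d₀
  | Z :: b, d => ∃ d₁, Assigned d₀ rows b d₁ ∧ (d₁, Z, d) ∈ rows

/-- The table allows acceptance from the configuration. -/
def Allowed (d₀ : ℕ) (rows : List (ℕ × ℕ × ℕ)) (T : List (ℕ × S × S)) (acc : List (ℕ × S)) :
    S → List ℕ → List ℕ → Prop
  | q, [], b => ∀ d, Assigned d₀ rows b d → (d, q) ∈ acc
  | q, Y :: u, b => ∀ d, Assigned d₀ rows b d →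
      ∃ q', (d, q, q') ∈ T ∧ Allowed d₀ rows T acc q' u (Y :: b)

/-- `Allowed` holds at the accepting configuration and is preserved backwards along moves, so it
contains all co-reachable configurations, whereas the table excludes the initial one. An entry of
`T` includes the `up` move that leaves the part of the stack. A stack with a symbol that is never
written may have no number; then `Allowed` holds vacuously, which is harmless for an upper bound. -/
theorem Refutes.not_coReach {L : List (Instr S)} {start fin : S} {t : Table S}
    (h : Refutes L start fin t) : ¬ (ofList L start fin).CoReach (start, [], []) := by
  obtain ⟨d₀, dl, rows, T, acc⟩ := t
  obtain ⟨h₀, hfin, hstart, htot, hdl, hcl⟩ := h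
  simp only at h₀ hfin hstart htot hdl hcl
  have hmem : ∀ b d, Assigned d₀ rows b d → d ∈ dl := by
    intro b d hb
    cases b with
    | nil => exact hb ▸ h₀
    | cons Z b =>
      obtain ⟨d₁, -, hr⟩ := hb
      exact hdl _ hr
  have htot' : ∀ {e : Instr S}, e ∈ L → ∀ {b d}, Assigned d₀ rows b d →
      ∃ d', (d, e.2.2.2.2.1, d') ∈ rows := by
    intro e he b d hb
    obtain ⟨⟨_, _, d'⟩, hr, rfl, rfl⟩ := htot d (hmem _ _ hb) e he
    exact ⟨d', hr⟩
  suffices H : ∀ c, (ofList L start fin).CoReach c → Allowed d₀ rows T acc c.1 c.2.1 c.2.2 from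
    fun hc => hstart (H _ hc d₀ rfl)
  intro c hc
  induction hc using Relation.ReflTransGen.head_induction_on with
  | refl => intro d hd; obtain rfl : d = d₀ := hd; exact hfin
  | head hs _ ih =>
    obtain ⟨k, a, hs⟩ := hs
    cases hs with
    | look Y u b hl =>
      obtain ⟨X, hl⟩ := hl
      rintro d ⟨d₁, hb, hr⟩
      obtain ⟨q', h₁, h₂⟩ := ih d ⟨d₁, hb, hr⟩
      exact ⟨q', (hcl _ hl _ hr).1 rfl rfl _ h₁ rfl rfl, h₂⟩
    | top b ht =>
      rintro d ⟨d₁, hb, hr⟩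
      obtain ⟨d', hr'⟩ := htot' ht hb
      exact (hcl _ ht _ hr).2.1 rfl rfl _ hr' rfl rfl (ih d' ⟨d₁, hb, hr'⟩)
    | up Z Y u b hu =>
      obtain ⟨a, Z', Y', hu⟩ := hu
      rintro d ⟨d₁, hb, hr⟩
      exact ⟨_, (hcl _ hu _ hr).2.2.1 rfl, ih⟩
    | down Z Y u b hd =>
      obtain ⟨a, Z', Y', hd⟩ := hd
      have h₃ := fun d₁ (hb : Assigned d₀ rows (Z :: b) d₁) d (hr : (d₁, Y, d) ∈ rows) =>
        (hcl _ hd _ hr).2.2.2.1 rfl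
      cases u with
      | nil =>
        rintro d ⟨d₁, hb, hr⟩
        obtain ⟨q', h₁, h₂⟩ := ih d₁ hb
        exact (h₃ d₁ hb d hr _ h₁ rfl rfl).1 (h₂ d ⟨d₁, hb, hr⟩)
      | cons X u =>
        rintro d ⟨d₁, hb, hr⟩
        obtain ⟨q', h₁, h₂⟩ := ih d₁ hb
        obtain ⟨q'', h₄, h₅⟩ := h₂ d ⟨d₁, hb, hr⟩
        exact ⟨q'', (h₃ d₁ hb d hr _ h₁ rfl rfl).2 _ h₄ rfl rfl, h₅⟩
    | push b hu =>
      obtain ⟨a, Z', hu⟩ := hu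
      intro d hb
      obtain ⟨d', hr⟩ := htot' hu hb
      exact (hcl _ hu _ hr).2.2.2.2.1 rfl rfl (ih d' ⟨d, hb, hr⟩)
    | pop b hu =>
      obtain ⟨a, Y', hu⟩ := hu
      rintro d ⟨d₁, hb, hr⟩
      exact (hcl _ hu _ hr).2.2.2.2.2 rfl rfl (ih d₁ hb)

theorem exists_list_mem_iff {α : Type*} {s : Set α} (hs : s.Finite) :
    ∃ l : List α, ∀ x, x ∈ l ↔ x ∈ s :=
  ⟨hs.toFinset.toList, by simp⟩

/-- The table consists of the true facts about all stacks over the relevant symbols, each stack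
being numbered by its type. Since the type determines these facts and is compatible with pushing,
the table is closed. -/
theorem exists_refutes {L : List (Instr S)} {start fin : S}
    (h : ¬ (ofList L start fin).CoReach (start, [], [])) : ∃ t, Refutes L start fin t := by
  have : Finite {p // p ∈ statesOf L start fin} := (List.finite_toSet _).to_subtype
  have : Finite {X // X ∈ symbolsOf L} := (List.finite_toSet _).to_subtype
  have hM := isClosedUnder_ofList L start fin
  rw [← show mapConfig Subtype.val Subtype.val
    ((restrictList L start fin).start, [], []) = (start, [], []) from rfl,
    ← hM.coReach_iff (start := (restrictList L start fin).start)
      (fin := (restrictList L start fin).fin) Subtype.val_injective rfl] at h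
  change ¬ (restrictList L start fin).CoReach _ at h
  have hlook : ∀ p a Z q, (restrictList L start fin).look p a Z q =
    ∃ Y, (0, p.1, a, Z.1, Y, q.1) ∈ L := fun _ _ _ _ => rfl
  have htop : ∀ p a Z Y q, (restrictList L start fin).top p a Z Y q =
    ((1, p.1, a, Z.1, Y.1, q.1) ∈ L) := fun _ _ _ _ _ => rfl
  have hup : ∀ p q, (restrictList L start fin).up p q =
    ∃ a Z Y, (2, p.1, a, Z, Y, q.1) ∈ L := fun _ _ => rfl
  have hdown : ∀ p q, (restrictList L start fin).down p q =
    ∃ a Z Y, (3, p.1, a, Z, Y, q.1) ∈ L := fun _ _ => rfl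
  have hpush : ∀ p X q, (restrictList L start fin).push p X q =
    ∃ a Z, (4, p.1, a, Z, X.1, q.1) ∈ L := fun _ _ _ => rfl
  have hpop : ∀ p X q, (restrictList L start fin).pop p X q =
    ∃ a Y, (5, p.1, a, X.1, Y, q.1) ∈ L := fun _ _ _ => rfl
  have hfin' : (restrictList L start fin).fin.1 = fin := rfl
  have hstart' : (restrictList L start fin).start.1 = start := rfl
  generalize restrictList L start fin = M at *
  obtain ⟨n, ⟨num⟩⟩ := Finite.exists_equiv_fin
    (Option {X // X ∈ symbolsOf L} ×
      ({p // p ∈ statesOf L start fin} → {p // p ∈ statesOf L start fin} → Prop) ×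
      ({p // p ∈ statesOf L start fin} → Prop) × ({p // p ∈ statesOf L start fin} → Prop))
  -- Equality of numbers is equality of types, so an entry found for one stack is valid for every
  -- stack with the same number.
  let ν : List {X // X ∈ symbolsOf L} → ℕ := fun b => num (M.stackType b)
  have hν : ∀ {b b'}, ν b = ν b' → M.stackType b = M.stackType b' :=
    fun h => num.injective (Fin.ext h)
  have hνfin : (Set.range ν).Finite :=
    (Set.finite_range fun i : Fin n => (i : ℕ)).subset (by rintro _ ⟨b, rfl⟩; exact ⟨_, rfl⟩)
  have hS : (Set.range (Subtype.val : {p // p ∈ statesOf L start fin} → S)).Finite :=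
    Set.finite_range _
  have hG : (Set.range (Subtype.val : {X // X ∈ symbolsOf L} → ℕ)).Finite :=
    Set.finite_range _
  obtain ⟨dl, hdl⟩ := exists_list_mem_iff hνfin
  obtain ⟨rows, hrows⟩ := exists_list_mem_iff
    (s := {x : ℕ × ℕ × ℕ | ∃ b Z, x = (ν b, Z.1, ν (Z :: b))})
    ((hνfin.prod (hG.prod hνfin)).subset (by rintro _ ⟨b, Z, rfl⟩; simp))
  obtain ⟨T, hT⟩ := exists_list_mem_iff
    (s := {x : ℕ × S × S | ∃ Z b p p' q, M.Inner (Z :: b) p p' ∧ M.up p' q ∧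
      x = (ν (Z :: b), p.1, q.1)})
    ((hνfin.prod (hS.prod hS)).subset (by rintro _ ⟨Z, b, p, p', q, -, -, rfl⟩; simp))
  obtain ⟨acc, hacc⟩ := exists_list_mem_iff
    (s := {x : ℕ × S | ∃ b p, M.CoReach (p, [], b) ∧ x = (ν b, p.1)})
    ((hνfin.prod hS).subset (by rintro _ ⟨b, p, -, rfl⟩; simp))
  have hacc' : ∀ {b p}, (ν b, p.1) ∈ acc → M.CoReach (p, [], b) := by
    intro b p hp
    obtain ⟨b', p', h₁, h₂⟩ := (hacc _).1 hp
    simp only [Prod.mk.injEq] at h₂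
    obtain rfl : p = p' := Subtype.ext h₂.2
    exact (coReach_iff_of_stackType_eq (hν h₂.1) p).2 h₁
  have hT' : ∀ {b p q}, (ν b, p, q) ∈ T → ∃ Z b₀ p₀ p' q', b = Z :: b₀ ∧ p₀.1 = p ∧ q'.1 = q ∧
      M.Inner b p₀ p' ∧ M.up p' q' := by
    intro b p q hp
    obtain ⟨Z, b', p₀, p', q', h₁, h₂, h₃⟩ := (hT _).1 hp
    simp only [Prod.mk.injEq] at h₃
    have h₄ := hν h₃.1
    have h₅ := head?_eq_of_stackType_eq h₄
    cases b with
    | nil => simp at h₅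
    | cons Z' b =>
      rw [← inner_eq_of_stackType_eq h₄] at h₁
      exact ⟨Z', b, p₀, p', q', rfl, h₃.2.1.symm, h₃.2.2.symm, h₁, h₂⟩
  refine ⟨(ν [], dl, rows, T, acc), (hdl _).2 ⟨[], rfl⟩, (hacc _).2 ⟨[], M.fin, .refl, by
    rw [hfin']⟩, fun h₁ => h (hacc' (b := []) (by rwa [hstart'])), ?_, ?_, ?_⟩
  · intro d hd e he
    obtain ⟨b, rfl⟩ := (hdl d).1 hd
    exact ⟨_, (hrows _).2 ⟨b, ⟨e.2.2.2.2.1, List.mem_map_of_mem he⟩, rfl⟩, rfl, rfl⟩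
  · intro r hr
    obtain ⟨b, Z, rfl⟩ := (hrows r).1 hr
    exact (hdl _).2 ⟨_, rfl⟩
  · rintro ⟨k, p, a, Z, Y, q⟩ he r hr
    obtain ⟨b, X, rfl⟩ := (hrows r).1 hr
    obtain ⟨p, rfl⟩ : ∃ p' : {p // p ∈ statesOf L start fin}, p'.1 = p :=
      ⟨⟨p, src_mem_statesOf he⟩, rfl⟩
    obtain ⟨q, rfl⟩ : ∃ q' : {p // p ∈ statesOf L start fin}, q'.1 = q :=
      ⟨⟨q, dst_mem_statesOf he⟩, rfl⟩
    have acc_of : ∀ {b p}, M.CoReach (p, [], b) → (ν b, p.1) ∈ acc :=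
      fun h => (hacc _).2 ⟨_, _, h, rfl⟩
    have T_of : ∀ {Z b p p' q}, M.Inner (Z :: b) p p' → M.up p' q →
        (ν (Z :: b), p.1, q.1) ∈ T := fun h₁ h₂ => (hT _).2 ⟨_, _, _, _, _, h₁, h₂, rfl⟩
    refine ⟨?_, ?_, ?_, ?_, ?_, ?_⟩
    · rintro rfl rfl ⟨_, _, q'⟩ hx rfl rfl
      obtain ⟨_, _, p₀, p', q₀, -, h₁, rfl, h₂, h₃⟩ := hT' hx
      obtain rfl : p₀ = q := Subtype.ext h₁
      have hl : M.look p a X p₀ := (hlook _ _ _ _).symm ▸ ⟨Y, he⟩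
      exact T_of (.head (.look _ _ hl) h₂) h₃
    · rintro rfl rfl r' hr' h₁ h₂ h₃
      obtain ⟨b', Y, rfl⟩ := (hrows r').1 hr'
      simp only at h₁ h₂
      subst h₂
      refine acc_of (.head (Step.top b ((htop _ a _ _ _).symm ▸ he)).move ?_)
      exact (coReach_cons_iff (hν h₁) q [] Y []).1 (hacc' h₃)
    · rintro rfl
      exact T_of .refl ((hup _ _).symm ▸ ⟨a, Z, Y, he⟩)
    · rintro rfl ⟨_, _, q'⟩ hx rfl h₁
      obtain ⟨W, b₀, p₀, p', q₀, rfl, h₂, rfl, h₃, h₄⟩ := hT' hx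
      obtain rfl : p₀ = q := Subtype.ext (h₂.trans h₁)
      have hd : M.down p p₀ := (hdown _ _).symm ▸ ⟨a, Z, Y, he⟩
      constructor
      · intro h₅
        exact acc_of (.head (Step.down W X [] b₀ hd).move
          ((lift_inner h₃ X []).trans (.head (Step.up W X [] b₀ h₄).move (hacc' h₅))))
      · rintro ⟨_, _, q₁⟩ hy rfl rfl
        obtain ⟨_, _, p₁, p₂, q₂, -, h₆, rfl, h₇, h₈⟩ := hT' hy
        obtain rfl : p₁ = q₀ := Subtype.ext h₆
        exact T_of (.head (.down W X [] b₀ hd) ((lift_in h₃ [X]).trans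
          (.head (.up W X [] b₀ h₄) h₇))) h₈
    · rintro rfl rfl h₁
      exact acc_of (.head (Step.push b ((hpush _ X _).symm ▸ ⟨a, Z, he⟩)).move (hacc' h₁))
    · rintro rfl rfl h₁
      exact acc_of (.head (Step.pop b ((hpop _ X _).symm ▸ ⟨a, Y, he⟩)).move (hacc' h₁))

end ElemMachine

/-! ### Membership of a word in a segment language as acceptance -/

namespace ElemMachine

variable {S : Type*}

/-- Whether an instruction of kind `k` and label `a` may be used when the number of letters of `w`
that have been read changes from `j` to `j'`, in a computation that reads `w` in a segment of the
mode `m`. -/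
def SegmentCond (w : List ℕ) (m : ℕ × ℕ) (k : ℕ) (a : Option ℕ) (j j' : ℕ) : Prop :=
  j ≤ w.length ∧ (j' = j ∧ (j = 0 ∨ j = w.length ∨ k = m.2 ∨ k = m.1 ∧ a = none) ∨
    j' = j + 1 ∧ k = m.1 ∧ a ≠ none ∧ w[j]? = a)

/-- The list of instructions of a machine that simulates computations of `L` in which `w` is read
in a segment of the mode `m`. -/
def segmentList (w : List ℕ) (m : ℕ × ℕ) (L : List (Instr S)) : List (Instr (ℕ × S)) :=
  (List.range (w.length + 1)).flatMap fun j => L.flatMap fun e =>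
    (if j = 0 ∨ j = w.length ∨ e.1 = m.2 ∨ e.1 = m.1 ∧ e.2.2.1 = none then
      [(e.1, (j, e.2.1), e.2.2.1, e.2.2.2.1, e.2.2.2.2.1, (j, e.2.2.2.2.2))] else []) ++
    (if e.1 = m.1 ∧ e.2.2.1 ≠ none ∧ w[j]? = e.2.2.1 then
      [(e.1, (j, e.2.1), e.2.2.1, e.2.2.2.1, e.2.2.2.2.1, (j + 1, e.2.2.2.2.2))] else [])

theorem mem_segmentList {w : List ℕ} {m : ℕ × ℕ} {L : List (Instr S)} {k : ℕ} {p q : ℕ × S}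
    {a : Option ℕ} {Z Y : ℕ} : (k, p, a, Z, Y, q) ∈ segmentList w m L ↔
      (k, p.2, a, Z, Y, q.2) ∈ L ∧ SegmentCond w m k a p.1 q.1 := by
  obtain ⟨j, p⟩ := p
  obtain ⟨j', q⟩ := q
  simp only [segmentList, List.mem_flatMap, List.mem_range, List.mem_append, SegmentCond]
  constructor
  · rintro ⟨i, hi, ⟨k₁, p₁, a₁, Z₁, Y₁, q₁⟩, he, h⟩
    rcases h with h | h <;> split_ifs at h with hc
    · simp only [List.mem_singleton, Prod.mk.injEq] at h
      obtain ⟨rfl, ⟨rfl, rfl⟩, rfl, rfl, rfl, rfl, rfl⟩ := h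
      exact ⟨he, by omega, .inl ⟨rfl, hc⟩⟩
    · simp at h
    · simp only [List.mem_singleton, Prod.mk.injEq] at h
      obtain ⟨rfl, ⟨rfl, rfl⟩, rfl, rfl, rfl, rfl, rfl⟩ := h
      exact ⟨he, by omega, .inr ⟨rfl, hc⟩⟩
    · simp at h
  · rintro ⟨he, hj, ⟨rfl, h⟩ | ⟨rfl, h⟩⟩
    · exact ⟨j', by omega, _, he, .inl (by rw [if_pos h]; simp)⟩
    · exact ⟨j, by omega, _, he, .inr (by rw [if_pos h]; simp)⟩

/-- `ofList` forgets the labels of instructions of kind at least 2, so the condition must not depend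
on them. -/
theorem segmentCond_label {w : List ℕ} {m : ℕ × ℕ} (hm : m.1 ≤ 1) {k : ℕ} (hk : 2 ≤ k)
    {a a' : Option ℕ} {j j' : ℕ} (h : SegmentCond w m k a j j') : SegmentCond w m k a' j j' := by
  obtain ⟨h₁, h₂⟩ := h
  refine ⟨h₁, ?_⟩
  rcases h₂ with ⟨h₂, h₃⟩ | ⟨_, h₃, _⟩
  · refine .inl ⟨h₂, ?_⟩
    rcases h₃ with h | h | h | ⟨h, -⟩
    · exact .inl h
    · exact .inr (.inl h)
    · exact .inr (.inr (.inl h))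
    · omega
  · omega

theorem step_segmentList {w : List ℕ} {m : ℕ × ℕ} (hm : m.1 ≤ 1) {L : List (Instr S)}
    {st fn : S} {st' fn' : ℕ × S} {k : ℕ} {a : Option ℕ} {j j' : ℕ} {c c' : S × List ℕ × List ℕ} :
    (ofList (segmentList w m L) st' fn').Step k a ((j, c.1), c.2) ((j', c'.1), c'.2) ↔
      (ofList L st fn).Step k a c c' ∧ SegmentCond w m k a j j' := by
  obtain ⟨p, u, b⟩ := c
  obtain ⟨p', u', b'⟩ := c'
  constructor
  · intro h
    cases h with
    | look Y u b h =>
      obtain ⟨X, h⟩ := h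
      obtain ⟨h₁, h₂⟩ := mem_segmentList.1 h
      exact ⟨.look Y u b ⟨X, h₁⟩, h₂⟩
    | top b h =>
      obtain ⟨h₁, h₂⟩ := mem_segmentList.1 h
      exact ⟨.top b h₁, h₂⟩
    | up Z Y u b h =>
      obtain ⟨a, Z', Y', h⟩ := h
      obtain ⟨h₁, h₂⟩ := mem_segmentList.1 h
      exact ⟨.up Z Y _ b ⟨a, Z', Y', h₁⟩, segmentCond_label hm (by norm_num) h₂⟩
    | down Z Y u b h =>
      obtain ⟨a, Z', Y', h⟩ := h
      obtain ⟨h₁, h₂⟩ := mem_segmentList.1 h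
      exact ⟨.down Z Y _ b ⟨a, Z', Y', h₁⟩, segmentCond_label hm (by norm_num) h₂⟩
    | push b h =>
      obtain ⟨a, Z', h⟩ := h
      obtain ⟨h₁, h₂⟩ := mem_segmentList.1 h
      exact ⟨.push b ⟨a, Z', h₁⟩, segmentCond_label hm (by norm_num) h₂⟩
    | pop b h =>
      obtain ⟨a, Z', h⟩ := h
      obtain ⟨h₁, h₂⟩ := mem_segmentList.1 h
      exact ⟨.pop _ ⟨a, Z', h₁⟩, segmentCond_label hm (by norm_num) h₂⟩
  · rintro ⟨h, hc⟩
    cases h with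
    | look Y u b h =>
      obtain ⟨X, h⟩ := h
      exact .look Y u b ⟨X, mem_segmentList.2 ⟨h, hc⟩⟩
    | top b h => exact .top b (mem_segmentList.2 ⟨h, hc⟩)
    | up Z Y u b h =>
      obtain ⟨a, Z', Y', h⟩ := h
      exact .up Z Y _ b ⟨a, Z', Y', mem_segmentList.2
        ⟨h, segmentCond_label hm (by norm_num) hc⟩⟩
    | down Z Y u b h =>
      obtain ⟨a, Z', Y', h⟩ := h
      exact .down Z Y _ b ⟨a, Z', Y', mem_segmentList.2
        ⟨h, segmentCond_label hm (by norm_num) hc⟩⟩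
    | push b h =>
      obtain ⟨a, Z', h⟩ := h
      exact .push b ⟨a, Z', mem_segmentList.2 ⟨h, segmentCond_label hm (by norm_num) hc⟩⟩
    | pop b h =>
      obtain ⟨a, Z', h⟩ := h
      exact .pop _ ⟨a, Z', mem_segmentList.2 ⟨h, segmentCond_label hm (by norm_num) hc⟩⟩

theorem Step.label_eq_none {G A : Type*} {M : ElemMachine S G A} {k : ℕ} {a : Option A}
    {c c' : S × List G × List G} (h : M.Step k a c c') (hk : 2 ≤ k) : a = none := by
  cases h <;> first | rfl | omega

/-- The counter is 0 before the segment and `w.length` after it, where all moves are allowed and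
their labels are ignored; in between only moves of the mode are allowed, and a labelled one must
read the next letter of `w`. -/
theorem segmentList_coReach_iff {w : List ℕ} {m : ℕ × ℕ} (hm : m ∈ segmentModes)
    (L : List (Instr S)) (st fn : S) :
    (ofList (segmentList w m L) (0, st) (w.length, fn)).CoReach ((0, st), [], []) ↔
      w ∈ (ofList L st fn).segmentLang {m.1, m.2} := by
  have hm₁ : m.1 ≤ 1 := by
    simp only [segmentModes, List.mem_cons, List.not_mem_nil, or_false] at hm
    rcases hm with rfl | rfl | rfl | rfl <;> norm_num
  have hm₂ : 2 ≤ m.2 := by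
    simp only [segmentModes, List.mem_cons, List.not_mem_nil, or_false] at hm
    rcases hm with rfl | rfl | rfl | rfl <;> norm_num
  have hstep : ∀ {k a j j' c c'}, (ofList (segmentList w m L) (0, st) (w.length, fn)).Step k a
      ((j, Prod.fst c), c.2) ((j', c'.1), c'.2) ↔
      (ofList L st fn).Step k a c c' ∧ SegmentCond w m k a j j' := step_segmentList hm₁
  constructor
  · intro h
    suffices H : ∀ d, Relation.ReflTransGen
        (ofList (segmentList w m L) (0, st) (w.length, fn)).Move ((0, st), [], []) d →
        (∃ c, (ofList L st fn).Reach c ∧ LabelledPath (ofList L st fn).Step {m.1, m.2} c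
          (w.take d.1.1) (d.1.2, d.2)) ∨
        d.1.1 = w.length ∧ ∃ c c', (ofList L st fn).Reach c ∧
          LabelledPath (ofList L st fn).Step {m.1, m.2} c w c' ∧
          Relation.ReflTransGen (ofList L st fn).Move c' (d.1.2, d.2) by
      rcases H _ h with ⟨c, h₁, h₂⟩ | ⟨-, c, c', h₁, h₂, h₃⟩
      · exact ⟨c, _, h₁, by simpa [ofList] using h₂, .refl⟩
      · exact ⟨c, c', h₁, h₂, h₃⟩
    intro d hd
    induction hd with
    | refl => exact .inl ⟨_, .refl, .refl _⟩
    | @tail d d' _ hs ih =>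
      obtain ⟨k, a, hs⟩ := hs
      obtain ⟨⟨j, p⟩, u, b⟩ := d
      obtain ⟨⟨j', p'⟩, u', b'⟩ := d'
      obtain ⟨ht, hj, hc⟩ := (hstep (c := (p, u, b)) (c' := (p', u', b'))).1 hs
      simp only at ih ⊢
      rcases ih with ⟨c, h₁, h₂⟩ | ⟨rfl, c, c', h₁, h₂, h₃⟩
      · rcases hc with ⟨rfl, hc⟩ | ⟨rfl, hk, ha, hw⟩
        -- At counter 0 nothing of `w` has been read, so the segment may be taken to start afresh
        -- after an arbitrary move. At counter `w.length` the segment is declared finished.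
        · rcases hc with rfl | rfl | hk | ⟨hk, rfl⟩
          · exact .inl ⟨_, (h₁.trans (reflTransGen_of_path h₂)).tail ht.move,
              by simpa using LabelledPath.refl _⟩
          · exact .inr ⟨rfl, c, _, h₁, by simpa using h₂, .single ht.move⟩
          · obtain rfl := ht.label_eq_none (by omega)
            exact .inl ⟨c, h₁, by simpa using h₂.snoc (.inr hk) ht⟩
          · exact .inl ⟨c, h₁, by simpa using h₂.snoc (.inl hk) ht⟩
        · obtain ⟨x, rfl⟩ := Option.ne_none_iff_exists'.1 ha
          refine .inl ⟨c, h₁, ?_⟩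
          rw [List.take_add_one, hw]
          exact h₂.snoc (.inl hk) ht
      · rcases hc with ⟨rfl, hc⟩ | ⟨rfl, hk, ha, hw⟩
        · exact .inr ⟨rfl, c, c', h₁, h₂, h₃.tail ht.move⟩
        · simp at hw; exact absurd hw.symm ha
  · rintro ⟨c, c', h₁, h₂, h₃⟩
    have lift : ∀ j, j = 0 ∨ j = w.length → ∀ {d d'},
        Relation.ReflTransGen (ofList L st fn).Move d d' →
        Relation.ReflTransGen (ofList (segmentList w m L) (0, st) (w.length, fn)).Move
          ((j, d.1), d.2) ((j, d'.1), d'.2) := by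
      intro j hj d d' h
      induction h with
      | refl => exact .refl
      | tail _ hs ih =>
        obtain ⟨k, a, hs⟩ := hs
        refine ih.tail ⟨k, a, hstep.2 ⟨hs, by omega, .inl ⟨rfl, ?_⟩⟩⟩
        rcases hj with h | h
        · exact .inl h
        · exact .inr (.inl h)
    refine (lift 0 (.inl rfl) h₁).trans (.trans ?_ (lift w.length (.inr rfl) h₃))
    suffices H : ∀ {c v c'}, LabelledPath (ofList L st fn).Step {m.1, m.2} c v c' →
        ∀ x, w = x ++ v → Relation.ReflTransGen
          (ofList (segmentList w m L) (0, st) (w.length, fn)).Move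
          ((x.length, c.1), c.2) ((w.length, c'.1), c'.2) from H h₂ [] rfl
    intro c v c' h
    induction h with
    | refl => rintro x rfl; simpa using Relation.ReflTransGen.refl
    | @cons c c₁ c₂ k a v hk hs _ ih =>
      intro x hx
      cases a with
      | none =>
        refine .head ⟨k, none, hstep.2 ⟨hs, by simp [hx], .inl ⟨rfl, ?_⟩⟩⟩ (ih x hx)
        rcases hk with h | h
        · exact .inr (.inr (.inr ⟨h, rfl⟩))
        · exact .inr (.inr (.inl h))
      | some a =>
        have hk' : k = m.1 := by
          rcases hk with h | h
          · exact h
          · have := hs.label_eq_none (by rw [h]; exact hm₂)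
            simp at this
        have := ih (x ++ [a]) (by simp [hx])
        refine .head ⟨k, some a, hstep.2 ⟨hs, by simp [hx], .inr ⟨rfl, hk', by simp, ?_⟩⟩⟩
          (by simpa using this)
        simp [hx]

end ElemMachine

/-! ### Compilation of stack automata into elementary machines -/

/-- States of the elementary machine of a stack automaton: `(0, ρ, p)` has to push `ρ` and to go on
in state `p`; `(1, [], p)`, `(2, [], p)`, `(3, [], p)` have to move down, to move up, to pop;
`(4, [], 0)` is the start, and `(5, [], 0)` empties the stack. -/
abbrev ElemState := ℕ × List ℕ × ℕ

/-- Numerical descriptions of transitions. -/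
abbrev TransitionCode := ℕ × Option ℕ × Bool × ℕ × ℕ × ℕ × List ℕ

open ElemMachine

/-- Instructions that push `ρ`, beginning with the first symbol. -/
def pushInstrs : List ℕ → ℕ → List (Instr ElemState)
  | [], _ => []
  | X :: ρ, p => (4, (0, X :: ρ, p), none, X, X, (0, ρ, p)) :: pushInstrs ρ p

/-- The elementary instructions of a transition. -/
def transitionInstrs (t : TransitionCode) : List (Instr ElemState) :=
  if t.2.2.2.2.2.1 = 3 ∧ t.2.2.1 = false then [] else
    (if t.2.2.1 = true then 1 else 0, (0, [], t.1), t.2.1, t.2.2.2.1,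
      t.2.2.2.2.2.2.reverse.head?.getD t.2.2.2.1,
      -- If no symbols are to be written, the number of the action is at the same time the tag of
      -- the next state. Otherwise the reading move leaves the lowest symbol of `γ`, and the others
      -- are pushed upwards from there.
      if t.2.2.2.2.2.2 = [] then (t.2.2.2.2.2.1, [], t.2.2.2.2.1)
      else (0, t.2.2.2.2.2.2.reverse.tail, t.2.2.2.2.1)) ::
    (3, (1, [], t.2.2.2.2.1), none, 0, 0, (0, [], t.2.2.2.2.1)) ::
    (2, (2, [], t.2.2.2.2.1), none, 0, 0, (0, [], t.2.2.2.2.1)) ::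
    (5, (3, [], t.2.2.2.2.1), none, t.2.2.2.1, 0, (0, [], t.2.2.2.2.1)) ::
    pushInstrs t.2.2.2.2.2.2.reverse.tail t.2.2.2.2.1

/-- The elementary instructions of a stack automaton. -/
def elemInstrs (c : StackAutomatonCode) : List (Instr ElemState) :=
  (4, (4, [], 0), none, 0, c.2.2.2.2.1, (0, [], c.2.2.2.1)) ::
  (2, (5, [], 0), none, 0, 0, (5, [], 0)) ::
  (c.2.2.2.2.2.2.flatMap transitionInstrs ++
    (c.2.2.2.2.2.1.flatMap (fun p =>
      [(4, (0, [], p), none, 0, 0, (5, [], 0)), (2, (0, [], p), none, 0, 0, (5, [], 0))]) ++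
    (List.range c.2.2.1).map fun Z => (5, (5, [], 0), none, Z, 0, (5, [], 0))))

/-- The elementary machine of a stack automaton. -/
def elemMachine (c : StackAutomatonCode) : ElemMachine ElemState ℕ ℕ :=
  ofList (elemInstrs c) (4, [], 0) (5, [], 0)

namespace StackAutomaton

variable {q s g : ℕ}

/-- The symbol left at the top by the reading move of a transition. -/
def readSymbol (Z : Fin g) : StackAction (Fin g) → Fin g
  | .write γ => γ.reverse.head?.getD Z
  | _ => Z

/-- The state after the reading move of a transition to `p`. -/
def pendingState (p : Fin q) : StackAction (Fin g) → ElemState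
  | .stay => (0, [], p)
  | .down => (1, [], p)
  | .up => (2, [], p)
  | .write [] => (3, [], p)
  | .write (X :: γ) => (0, (X :: γ).reverse.tail.map Fin.val, p)

/-- The instructions of the elementary machine of `M`. -/
inductive Compiled (M : StackAutomaton (Fin q) (Fin s) (Fin g)) : Instr ElemState → Prop where
  | start : Compiled M (4, (4, [], 0), none, 0, M.bottom, (0, [], M.start))
  | clean : Compiled M (2, (5, [], 0), none, 0, 0, (5, [], 0))
  | cleanPop (Z : Fin g) : Compiled M (5, (5, [], 0), none, Z, 0, (5, [], 0))
  | finalPush {p : Fin q} : p ∈ M.final → Compiled M (4, (0, [], p), none, 0, 0, (5, [], 0))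
  | finalUp {p : Fin q} : p ∈ M.final → Compiled M (2, (0, [], p), none, 0, 0, (5, [], 0))
  | read {t : StackTransition (Fin q) (Fin s) (Fin g)} : t ∈ M.transitions →
      (∀ γ, t.action = .write γ → t.atTop = true) →
      Compiled M (if t.atTop = true then 1 else 0, (0, [], t.src), t.input.map Fin.val, t.scanned,
        readSymbol t.scanned t.action, pendingState t.dst t.action)
  | down {t : StackTransition (Fin q) (Fin s) (Fin g)} : t ∈ M.transitions →
      (∀ γ, t.action = .write γ → t.atTop = true) →
      Compiled M (3, (1, [], t.dst), none, 0, 0, (0, [], t.dst))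
  | up {t : StackTransition (Fin q) (Fin s) (Fin g)} : t ∈ M.transitions →
      (∀ γ, t.action = .write γ → t.atTop = true) →
      Compiled M (2, (2, [], t.dst), none, 0, 0, (0, [], t.dst))
  | pop {t : StackTransition (Fin q) (Fin s) (Fin g)} : t ∈ M.transitions →
      (∀ γ, t.action = .write γ → t.atTop = true) →
      Compiled M (5, (3, [], t.dst), none, t.scanned, 0, (0, [], t.dst))
  | push {t : StackTransition (Fin q) (Fin s) (Fin g)} {γ : List (Fin g)} {X : Fin g}
      {ρ : List (Fin g)} : t ∈ M.transitions → t.action = .write γ → t.atTop = true →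
      X :: ρ <:+ γ.reverse.tail →
      Compiled M (4, (0, X :: ρ.map Fin.val, t.dst), none, X, X, (0, ρ.map Fin.val, t.dst))

theorem mem_pushInstrs {e : Instr ElemState} {ρ : List (Fin g)} {p : ℕ} :
    e ∈ pushInstrs (ρ.map Fin.val) p ↔ ∃ (X : Fin g) (ρ' : List (Fin g)), X :: ρ' <:+ ρ ∧
      e = (4, (0, X.val :: ρ'.map Fin.val, p), none, X.val, X.val, (0, ρ'.map Fin.val, p)) := by
  induction ρ with
  | nil => simp [pushInstrs]
  | cons Y ρ ih =>
    simp only [List.map_cons, pushInstrs, List.mem_cons, ih, List.suffix_cons_iff,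
      List.cons.injEq]
    constructor
    · rintro (rfl | ⟨X, ρ', h, rfl⟩)
      · exact ⟨Y, ρ, .inl ⟨rfl, rfl⟩, rfl⟩
      · exact ⟨X, ρ', .inr h, rfl⟩
    · rintro ⟨X, ρ', ⟨rfl, rfl⟩ | h, rfl⟩
      · exact .inl rfl
      · exact .inr ⟨X, ρ', h, rfl⟩

theorem transitionInstrs_encode {t : StackTransition (Fin q) (Fin s) (Fin g)}
    (ht : ∀ γ, t.action = .write γ → t.atTop = true) :
    transitionInstrs t.encode =
      (if t.atTop = true then 1 else 0, (0, [], t.src.val), t.input.map Fin.val, t.scanned.val,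
        (readSymbol t.scanned t.action).val, pendingState t.dst t.action) ::
      (3, (1, [], t.dst.val), none, 0, 0, (0, [], t.dst.val)) ::
      (2, (2, [], t.dst.val), none, 0, 0, (0, [], t.dst.val)) ::
      (5, (3, [], t.dst.val), none, t.scanned.val, 0, (0, [], t.dst.val)) ::
      pushInstrs ((match t.action with | .write γ => γ.reverse.tail | _ => []).map Fin.val)
        t.dst.val := by
  obtain ⟨src, a, top, Z, dst, act⟩ := t
  cases act with
  | stay =>
    cases top <;>
      simp [transitionInstrs, StackTransition.encode, StackAction.encode, readSymbol, pendingState]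
  | down =>
    cases top <;>
      simp [transitionInstrs, StackTransition.encode, StackAction.encode, readSymbol, pendingState]
  | up =>
    cases top <;>
      simp [transitionInstrs, StackTransition.encode, StackAction.encode, readSymbol, pendingState]
  | write γ =>
    obtain rfl : top = true := ht γ rfl
    rcases List.eq_nil_or_concat γ with rfl | ⟨γ, X, rfl⟩
    · simp [transitionInstrs, StackTransition.encode, StackAction.encode, readSymbol,
        pendingState]
    · have : pendingState (g := g) dst (.write (γ ++ [X])) =
          (0, (γ ++ [X]).reverse.tail.map Fin.val, dst.val) := by
        cases γ <;> rfl
      simp [transitionInstrs, StackTransition.encode, StackAction.encode, readSymbol, this]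

theorem mem_elemInstrs {M : StackAutomaton (Fin q) (Fin s) (Fin g)} {e : Instr ElemState} :
    e ∈ elemInstrs M.encode ↔ M.Compiled e := by
  simp only [elemInstrs, StackAutomaton.encode, List.mem_cons, List.mem_append, List.mem_flatMap,
    List.mem_map, List.mem_range, List.not_mem_nil, or_false]
  constructor
  · rintro (rfl | rfl | ⟨_, ⟨t, ht, rfl⟩, he⟩ | ⟨_, ⟨p, hp, rfl⟩, rfl | rfl⟩ | ⟨Z, hZ, rfl⟩)
    · exact .start
    · exact .clean
    · by_cases hw : ∀ γ, t.action = .write γ → t.atTop = true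
      · rw [transitionInstrs_encode hw] at he
        simp only [List.mem_cons] at he
        rcases he with rfl | rfl | rfl | rfl | he
        · exact .read ht hw
        · exact .down ht hw
        · exact .up ht hw
        · exact .pop ht hw
        · obtain ⟨X, ρ, hρ, rfl⟩ := mem_pushInstrs.1 he
          cases hact : t.action with
          | write γ =>
            rw [hact] at hρ
            exact .push ht hact (hw γ hact) hρ
          | _ => rw [hact] at hρ; simp at hρ
      · push Not at hw
        obtain ⟨γ, hγ, h⟩ := hw
        simp [transitionInstrs, StackTransition.encode, hγ, StackAction.encode,
          Bool.eq_false_iff.2 h] at he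
    · exact .finalPush hp
    · exact .finalUp hp
    · exact .cleanPop ⟨Z, hZ⟩
  · intro h
    cases h with
    | start => exact .inl rfl
    | clean => exact .inr (.inl rfl)
    | cleanPop Z => exact .inr (.inr (.inr (.inr ⟨Z, Z.2, rfl⟩)))
    | finalPush hp => exact .inr (.inr (.inr (.inl ⟨_, ⟨_, hp, rfl⟩, .inl rfl⟩)))
    | finalUp hp => exact .inr (.inr (.inr (.inl ⟨_, ⟨_, hp, rfl⟩, .inr rfl⟩)))
    | read ht hw =>
      refine .inr (.inr (.inl ⟨_, ⟨_, ht, rfl⟩, ?_⟩))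
      rw [transitionInstrs_encode hw]
      simp
    | down ht hw =>
      refine .inr (.inr (.inl ⟨_, ⟨_, ht, rfl⟩, ?_⟩))
      rw [transitionInstrs_encode hw]
      simp
    | up ht hw =>
      refine .inr (.inr (.inl ⟨_, ⟨_, ht, rfl⟩, ?_⟩))
      rw [transitionInstrs_encode hw]
      simp
    | pop ht hw =>
      refine .inr (.inr (.inl ⟨_, ⟨_, ht, rfl⟩, ?_⟩))
      rw [transitionInstrs_encode hw]
      simp
    | @push t γ X ρ ht hact htop hρ =>
      refine .inr (.inr (.inl ⟨_, ⟨_, ht, rfl⟩, ?_⟩))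
      rw [transitionInstrs_encode (fun _ _ => htop), hact]
      simp only [List.mem_cons]
      exact .inr (.inr (.inr (.inr (mem_pushInstrs.2 ⟨X, ρ, hρ, rfl⟩))))

end StackAutomaton

/-! ### Accepting computations of the compiled machine come from the automaton -/

namespace StackAutomaton

variable {q s g : ℕ} {M : StackAutomaton (Fin q) (Fin s) (Fin g)}

theorem elemMachine_look {p r : ElemState} {a : Option ℕ} {Z : ℕ} :
    (elemMachine M.encode).look p a Z r → ∃ t ∈ M.transitions, t.atTop = false ∧
      (∀ γ, t.action ≠ .write γ) ∧ p = (0, [], t.src.val) ∧ a = t.input.map Fin.val ∧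
      Z = t.scanned.val ∧ r = pendingState t.dst t.action := by
  rintro ⟨Y, h⟩
  replace h := mem_elemInstrs.1 h
  generalize he : ((0, p, a, Z, Y, r) : Instr ElemState) = e at h
  cases h with
  | @read t ht hw =>
    simp only [Prod.mk.injEq] at he
    obtain ⟨h₁, rfl, rfl, rfl, -, rfl⟩ := he
    have htop : t.atTop = false := by by_contra h; simp [h] at h₁
    exact ⟨t, ht, htop, fun γ hγ => by simp [hw γ hγ] at htop, rfl, rfl, rfl, rfl⟩
  | _ => simp at he

theorem elemMachine_top {p r : ElemState} {a : Option ℕ} {Z Y : ℕ} :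
    (elemMachine M.encode).top p a Z Y r → ∃ t ∈ M.transitions, t.atTop = true ∧
      p = (0, [], t.src.val) ∧ a = t.input.map Fin.val ∧ Z = t.scanned.val ∧
      Y = (readSymbol t.scanned t.action).val ∧ r = pendingState t.dst t.action := by
  intro h
  replace h := mem_elemInstrs.1 h
  generalize he : ((1, p, a, Z, Y, r) : Instr ElemState) = e at h
  cases h with
  | @read t ht hw =>
    simp only [Prod.mk.injEq] at he
    obtain ⟨h₁, rfl, rfl, rfl, rfl, rfl⟩ := he
    exact ⟨t, ht, by by_contra h; simp [h] at h₁, rfl, rfl, rfl, rfl, rfl⟩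
  | _ => simp at he

theorem elemMachine_up {p r : ElemState} : (elemMachine M.encode).up p r →
    p = (5, [], 0) ∧ r = (5, [], 0) ∨ (∃ p' ∈ M.final, p = (0, [], p'.val) ∧ r = (5, [], 0)) ∨
      ∃ p' : Fin q, p = (2, [], p'.val) ∧ r = (0, [], p'.val) := by
  rintro ⟨a, Z, Y, h⟩
  replace h := mem_elemInstrs.1 h
  generalize he : ((2, p, a, Z, Y, r) : Instr ElemState) = e at h
  cases h with
  | read => simp only [Prod.mk.injEq] at he; split_ifs at he <;> simp at he
  | clean => simp only [Prod.mk.injEq] at he; exact .inl ⟨he.2.1, he.2.2.2.2.2⟩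
  | finalUp hp =>
    simp only [Prod.mk.injEq] at he; exact .inr (.inl ⟨_, hp, he.2.1, he.2.2.2.2.2⟩)
  | @up t => simp only [Prod.mk.injEq] at he; exact .inr (.inr ⟨t.dst, he.2.1, he.2.2.2.2.2⟩)
  | _ => simp at he

theorem elemMachine_down {p r : ElemState} : (elemMachine M.encode).down p r →
    ∃ p' : Fin q, p = (1, [], p'.val) ∧ r = (0, [], p'.val) := by
  rintro ⟨a, Z, Y, h⟩
  replace h := mem_elemInstrs.1 h
  generalize he : ((3, p, a, Z, Y, r) : Instr ElemState) = e at h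
  cases h with
  | read => simp only [Prod.mk.injEq] at he; split_ifs at he <;> simp at he
  | @down t => simp only [Prod.mk.injEq] at he; exact ⟨t.dst, he.2.1, he.2.2.2.2.2⟩
  | _ => simp at he

theorem elemMachine_push {p r : ElemState} {X : ℕ} : (elemMachine M.encode).push p X r →
    p = (4, [], 0) ∧ X = M.bottom.val ∧ r = (0, [], M.start.val) ∨
    (∃ p' ∈ M.final, p = (0, [], p'.val) ∧ r = (5, [], 0)) ∨
    ∃ (Y : Fin g) (ρ : List (Fin g)) (p' : Fin q), X = Y.val ∧
      p = (0, (Y :: ρ).map Fin.val, p'.val) ∧ r = (0, ρ.map Fin.val, p'.val) := by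
  rintro ⟨a, Z, h⟩
  replace h := mem_elemInstrs.1 h
  generalize he : ((4, p, a, Z, X, r) : Instr ElemState) = e at h
  cases h with
  | read => simp only [Prod.mk.injEq] at he; split_ifs at he <;> simp at he
  | start =>
    simp only [Prod.mk.injEq] at he; exact .inl ⟨he.2.1, he.2.2.2.2.1, he.2.2.2.2.2⟩
  | finalPush hp =>
    simp only [Prod.mk.injEq] at he; exact .inr (.inl ⟨_, hp, he.2.1, he.2.2.2.2.2⟩)
  | @push t _ X ρ =>
    simp only [Prod.mk.injEq] at he
    exact .inr (.inr ⟨X, ρ, t.dst, he.2.2.2.2.1, he.2.1, he.2.2.2.2.2⟩)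
  | _ => simp at he

theorem elemMachine_pop {p r : ElemState} {X : ℕ} : (elemMachine M.encode).pop p X r →
    p = (5, [], 0) ∧ r = (5, [], 0) ∨
      ∃ p' : Fin q, p = (3, [], p'.val) ∧ r = (0, [], p'.val) := by
  rintro ⟨a, Z, h⟩
  replace h := mem_elemInstrs.1 h
  generalize he : ((5, p, a, X, Z, r) : Instr ElemState) = e at h
  cases h with
  | read => simp only [Prod.mk.injEq] at he; split_ifs at he <;> simp at he
  | cleanPop => simp only [Prod.mk.injEq] at he; exact .inl ⟨he.2.1, he.2.2.2.2.2⟩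
  | @pop t => simp only [Prod.mk.injEq] at he; exact .inr ⟨t.dst, he.2.1, he.2.2.2.2.2⟩
  | _ => simp at he

/-- Emptying the stack reads nothing and cannot be interrupted, so the input is already consumed
when a final state hands over to cleaning. -/
theorem eq_nil_of_path_of_cleaning {c c' : ElemState × List ℕ × List ℕ} {w : List ℕ}
    (h : LabelledPath (elemMachine M.encode).Step Set.univ c w c') (hc : c.1 = (5, [], 0)) :
    w = [] := by
  induction h with
  | refl => rfl
  | cons hk hs _ ih =>
    cases hs with
    | look Y u b h =>
      obtain ⟨t, -, -, -, rfl, -⟩ := elemMachine_look h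
      simp at hc
    | top b h =>
      obtain ⟨t, -, -, rfl, -⟩ := elemMachine_top h
      simp at hc
    | up Z Y u b h =>
      rcases elemMachine_up h with ⟨rfl, rfl⟩ | ⟨p', -, rfl, rfl⟩ | ⟨p', rfl, rfl⟩
      · exact ih rfl
      · simp at hc
      · simp at hc
    | down Z Y u b h =>
      obtain ⟨p', rfl, rfl⟩ := elemMachine_down h
      simp at hc
    | push b h =>
      rcases elemMachine_push h with ⟨rfl, rfl, rfl⟩ | ⟨p', -, rfl, rfl⟩ |
        ⟨Y, ρ, p', rfl, rfl, rfl⟩ <;> simp at hc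
    | pop b h =>
      rcases elemMachine_pop h with ⟨rfl, rfl⟩ | ⟨p', rfl, rfl⟩
      · exact ih rfl
      · simp at hc

/-- `M` accepts the word with the numbers `w` from the given state and stack. -/
def AcceptsFrom (M : StackAutomaton (Fin q) (Fin s) (Fin g)) (p : Fin q) (u b : List (Fin g))
    (w : List ℕ) : Prop :=
  ∃ (v : List (Fin s)) (ds : List Bool) (C : StackConfig (Fin q) (Fin s) (Fin g)),
    v.map Fin.val = w ∧ M.Run ⟨p, v, u, b⟩ ds C ∧ C.input = [] ∧ C.state ∈ M.final

theorem AcceptsFrom.step {t : StackTransition (Fin q) (Fin s) (Fin g)} (ht : t ∈ M.transitions)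
    {u b u' b' : List (Fin g)} {w : List ℕ} (hb : b.head? = some t.scanned)
    (htop : t.atTop = true ↔ u = []) (hm : StackMove t.action u b u' b')
    (h : M.AcceptsFrom t.dst u' b' w) :
    M.AcceptsFrom t.src u b ((t.input.map Fin.val).toList ++ w) := by
  obtain ⟨v, ds, C, rfl, h₁, h₂, h₃⟩ := h
  refine ⟨t.input.toList ++ v, _, C, ?_, .step (t := t) ⟨ht, rfl, rfl, rfl, hb, htop, hm⟩ h₁,
    h₂, h₃⟩
  cases t.input <;> rfl

/-- What a configuration of the elementary machine that accepts `w` says about `M`. -/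
def Decoded (M : StackAutomaton (Fin q) (Fin s) (Fin g)) (w : List ℕ) (r : ElemState)
    (u b : List (Fin g)) : Prop :=
  (∀ (ρ : List (Fin g)) (p : Fin q), r = (0, ρ.map Fin.val, p.val) →
    M.AcceptsFrom p u (ρ.reverse ++ b) w) ∧
  (∀ p : Fin q, r = (1, [], p.val) → ∃ Z Y b', b = Z :: Y :: b' ∧
    M.AcceptsFrom p (Z :: u) (Y :: b') w) ∧
  (∀ p : Fin q, r = (2, [], p.val) → ∃ Y u' Z b', u = Y :: u' ∧ b = Z :: b' ∧
    M.AcceptsFrom p u' (Y :: Z :: b') w) ∧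
  (∀ p : Fin q, r = (3, [], p.val) → ∃ Z b', u = [] ∧ b = Z :: b' ∧ M.AcceptsFrom p [] b' w) ∧
  (r = (4, [], 0) → u = [] → b = [] → M.AcceptsFrom M.start [] [M.bottom] w)

theorem acceptsFrom_of_decoded {t : StackTransition (Fin q) (Fin s) (Fin g)}
    (ht : t ∈ M.transitions) {u b : List (Fin g)} {w : List ℕ} (htop : t.atTop = true ↔ u = [])
    (hw : ∀ γ, t.action = .write γ → t.atTop = true)
    (h : M.Decoded w (pendingState t.dst t.action) u (readSymbol t.scanned t.action :: b)) :
    M.AcceptsFrom t.src u (t.scanned :: b) ((t.input.map Fin.val).toList ++ w) := by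
  obtain ⟨h₀, h₁, h₂, h₃, -⟩ := h
  cases hact : t.action with
  | stay =>
    rw [hact] at h₀
    refine .step ht rfl htop ?_ (h₀ [] t.dst rfl)
    rw [hact]
    exact .stay _ _ _
  | down =>
    rw [hact] at h₁
    obtain ⟨Z, Y, b', hb, h₄⟩ := h₁ t.dst rfl
    simp only [readSymbol, List.cons.injEq] at hb
    obtain ⟨rfl, rfl⟩ := hb
    refine .step ht rfl htop ?_ h₄
    rw [hact]
    exact .down _ _ _ _
  | up =>
    rw [hact] at h₂
    obtain ⟨Y, u', Z, b', rfl, hb, h₄⟩ := h₂ t.dst rfl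
    simp only [readSymbol, List.cons.injEq] at hb
    obtain ⟨rfl, rfl⟩ := hb
    refine .step ht rfl htop ?_ h₄
    rw [hact]
    exact .up _ _ _ _
  | write γ =>
    obtain rfl := htop.1 (hw γ hact)
    have hm := StackMove.write t.scanned γ b
    rw [← hact] at hm
    refine .step ht rfl htop hm ?_
    rw [hact] at h₀ h₃
    cases γ with
    | nil =>
      obtain ⟨Z, b', -, hb, h₄⟩ := h₃ t.dst rfl
      simp only [List.cons.injEq] at hb
      obtain ⟨-, rfl⟩ := hb
      exact h₄
    | cons X γ =>
      have h := h₀ (X :: γ).reverse.tail t.dst rfl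
      rcases List.eq_nil_or_concat (X :: γ) with h' | ⟨γ', Y, h'⟩
      · simp at h'
      · rw [h'] at h ⊢
        simpa [readSymbol] using h

/-- The accepting computation is decoded from its end. Intermediate states only record the movement
still owed by the current transition; when the decoding arrives at the reading move,
`acceptsFrom_of_decoded` assembles the transition. -/
theorem decoded_of_path {c c' : ElemState × List ℕ × List ℕ} {w : List ℕ}
    (h : LabelledPath (elemMachine M.encode).Step Set.univ c w c')
    (hc' : c' = ((5, [], 0), [], [])) (u b : List (Fin g)) (hu : c.2.1 = u.map Fin.val)
    (hb : c.2.2 = b.map Fin.val) : M.Decoded w c.1 u b := by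
  have hinj := Fin.val_injective (n := g)
  induction h generalizing u b with
  | refl c =>
    subst hc'
    refine ⟨?_, ?_, ?_, ?_, ?_⟩ <;> simp
  | @cons c c₁ c₂ k a w hk hs hp ih =>
    specialize ih hc'
    cases hs with
    | look Y u' b' hl =>
      obtain ⟨t, ht, htop, hact, rfl, rfl, rfl, rfl⟩ := elemMachine_look hl
      cases u with
      | nil => simp at hu
      | cons Y u =>
        have hb₁ := hb
        cases b with
        | nil => simp at hb
        | cons Z b =>
          simp only [List.map_cons, List.cons.injEq] at hb
          obtain rfl := Fin.val_injective hb.1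
          have hd := ih (Y :: u) (t.scanned :: b) hu hb₁
          have hr : readSymbol t.scanned t.action = t.scanned := by
            cases ha : t.action with
            | write γ => exact absurd ha (hact γ)
            | _ => rfl
          have := acceptsFrom_of_decoded ht (u := Y :: u) (b := b) (w := w) (by simp [htop])
            (fun γ hγ => absurd hγ (hact γ)) (by rw [hr]; exact hd)
          refine ⟨?_, by simp, by simp, by simp, by simp⟩
          intro ρ p hρ
          simp only [Prod.mk.injEq, true_and] at hρ
          obtain rfl := List.map_eq_nil_iff.1 hρ.1.symm
          obtain rfl := Fin.val_injective hρ.2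
          exact this
    | top b' h' =>
      obtain ⟨t, ht, htop, rfl, rfl, rfl, rfl, rfl⟩ := elemMachine_top h'
      obtain rfl := List.map_eq_nil_iff.1 hu.symm
      cases b with
      | nil => simp at hb
      | cons Z b =>
        simp only [List.map_cons, List.cons.injEq] at hb
        obtain rfl := Fin.val_injective hb.1
        have hd := ih [] (readSymbol t.scanned t.action :: b) rfl (by simp [hb.2])
        have := acceptsFrom_of_decoded ht (by simp [htop]) (fun _ _ => htop) hd
        refine ⟨?_, by simp, by simp, by simp, by simp⟩
        intro ρ p hρ
        simp only [Prod.mk.injEq, true_and] at hρ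
        obtain rfl := List.map_eq_nil_iff.1 hρ.1.symm
        obtain rfl := Fin.val_injective hρ.2
        exact this
    | up Z Y u' b' h' =>
      obtain ⟨Y, u, rfl, rfl, rfl⟩ := List.map_eq_cons_iff.1 hu.symm
      obtain ⟨Z, b, rfl, rfl, rfl⟩ := List.map_eq_cons_iff.1 hb.symm
      have hd := ih u (Y :: Z :: b) rfl rfl
      rcases elemMachine_up h' with ⟨rfl, rfl⟩ | ⟨p', hp', rfl, rfl⟩ | ⟨p', rfl, rfl⟩
      · refine ⟨by simp, by simp, by simp, by simp, by simp⟩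
      · have := eq_nil_of_path_of_cleaning hp rfl
        subst this
        refine ⟨?_, by simp, by simp, by simp, by simp⟩
        intro ρ p hρ
        simp only [Prod.mk.injEq, true_and] at hρ
        obtain rfl := List.map_eq_nil_iff.1 hρ.1.symm
        obtain rfl := Fin.val_injective hρ.2
        exact ⟨[], [], _, rfl, .refl _, rfl, hp'⟩
      · refine ⟨by simp, by simp, ?_, by simp, by simp⟩
        intro p hp
        simp only [Prod.mk.injEq, true_and] at hp
        obtain rfl := Fin.val_injective hp
        exact ⟨Y, u, Z, b, rfl, rfl, hd.1 [] _ rfl⟩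
    | down Z Y u' b' h' =>
      obtain ⟨Y, b₂, rfl, rfl, hb₂⟩ := List.map_eq_cons_iff.1 hb.symm
      obtain ⟨Z, b, rfl, rfl, rfl⟩ := List.map_eq_cons_iff.1 hb₂
      have hd := ih (Y :: u) (Z :: b) (by simp [← hu]) rfl
      obtain ⟨p', rfl, rfl⟩ := elemMachine_down h'
      refine ⟨by simp, ?_, by simp, by simp, by simp⟩
      intro p hp
      simp only [Prod.mk.injEq, true_and] at hp
      obtain rfl := Fin.val_injective hp
      exact ⟨Y, Z, b, rfl, hd.1 [] _ rfl⟩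
    | push b' h' =>
      obtain rfl := List.map_eq_nil_iff.1 hu.symm
      rcases elemMachine_push h' with ⟨rfl, rfl, rfl⟩ | ⟨p', hp', rfl, rfl⟩ |
        ⟨Y, ρ, p', rfl, rfl, rfl⟩
      · refine ⟨by simp, by simp, by simp, by simp, ?_⟩
        rintro - - rfl
        exact (ih [] [M.bottom] rfl (by simpa using hb)).1 [] _ rfl
      · have hw : w = [] := eq_nil_of_path_of_cleaning hp rfl
        subst hw
        refine ⟨?_, by simp, by simp, by simp, by simp⟩
        intro ρ p hρ
        simp only [Prod.mk.injEq, true_and] at hρ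
        obtain rfl := List.map_eq_nil_iff.1 hρ.1.symm
        obtain rfl := Fin.val_injective hρ.2
        exact ⟨[], [], _, rfl, .refl _, rfl, hp'⟩
      · have hd := ih [] (Y :: b) rfl (by simpa using hb)
        refine ⟨?_, by simp, by simp, by simp, by simp⟩
        intro ρ' p hρ
        simp only [Prod.mk.injEq, true_and] at hρ
        obtain rfl := (List.map_injective_iff.2 hinj) hρ.1
        obtain rfl := Fin.val_injective hρ.2
        simpa using hd.1 ρ _ rfl
    | pop b' h' =>
      obtain rfl := List.map_eq_nil_iff.1 hu.symm
      obtain ⟨Z, b, rfl, rfl, rfl⟩ := List.map_eq_cons_iff.1 hb.symm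
      have hd := ih [] b rfl rfl
      rcases elemMachine_pop h' with ⟨rfl, rfl⟩ | ⟨p', rfl, rfl⟩
      · refine ⟨by simp, by simp, by simp, by simp, by simp⟩
      · refine ⟨by simp, by simp, by simp, ?_, by simp⟩
        intro p hp
        simp only [Prod.mk.injEq, true_and] at hp
        obtain rfl := Fin.val_injective hp
        exact ⟨Z, b, rfl, rfl, hd.1 [] _ rfl⟩

end StackAutomaton

/-! ### Cutting accepting computations into segments -/

namespace StackAutomaton

variable {q s g : ℕ} {M : StackAutomaton (Fin q) (Fin s) (Fin g)}

/-- The configuration of the elementary machine that corresponds to a configuration of `M`. -/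
def elemConfig (C : StackConfig (Fin q) (Fin s) (Fin g)) : ElemState × List ℕ × List ℕ :=
  ((0, [], C.state.val), C.above.map Fin.val, C.below.map Fin.val)

theorem reach_cleaning_top (M : StackAutomaton (Fin q) (Fin s) (Fin g)) (b : List (Fin g)) :
    (elemMachine M.encode).CoReach ((5, [], 0), [], b.map Fin.val) := by
  induction b with
  | nil => exact .refl
  | cons Z b ih =>
    exact .head (Step.pop (M := elemMachine M.encode) (b.map Fin.val)
      ⟨none, 0, mem_elemInstrs.2 (.cleanPop Z)⟩).move ih

theorem reach_cleaning (M : StackAutomaton (Fin q) (Fin s) (Fin g)) (u : List (Fin g)) (Z : Fin g)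
    (b : List (Fin g)) :
    (elemMachine M.encode).CoReach ((5, [], 0), u.map Fin.val, (Z :: b).map Fin.val) := by
  induction u generalizing Z b with
  | nil => exact reach_cleaning_top M (Z :: b)
  | cons Y u ih =>
    exact .head (Step.up (M := elemMachine M.encode) Z.val Y.val (u.map Fin.val) (b.map Fin.val)
      ⟨none, 0, 0, mem_elemInstrs.2 .clean⟩).move (ih Y (Z :: b))

/-- At the top, cleaning is entered by a `push`, which works on the empty stack too; below the top
it is entered by `up`. The invariant `hinv` excludes an empty lower part with symbols above it, from
which `up` would be impossible. -/
theorem coReach_of_final {C : StackConfig (Fin q) (Fin s) (Fin g)} (hC : C.state ∈ M.final)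
    (hinv : C.above = [] ∨ C.below ≠ []) : (elemMachine M.encode).CoReach (elemConfig C) := by
  obtain ⟨p, w, u, b⟩ := C
  -- Symbol 0, pushed on entering the cleaning phase, is a genuine stack symbol and will be popped
  -- again.
  have hg : 0 < g := M.bottom.pos
  cases u with
  | nil =>
    exact .head (Step.push (M := elemMachine M.encode) (b.map Fin.val)
      ⟨none, 0, mem_elemInstrs.2 (.finalPush hC)⟩).move
      (reach_cleaning_top M (⟨0, hg⟩ :: b))
  | cons Y u =>
    cases b with
    | nil => simp at hinv
    | cons Z b =>
      exact .head (Step.up (M := elemMachine M.encode) Z.val Y.val (u.map Fin.val) (b.map Fin.val)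
        ⟨none, 0, 0, mem_elemInstrs.2 (.finalUp hC)⟩).move (reach_cleaning M u Y (Z :: b))

theorem push_path {t : StackTransition (Fin q) (Fin s) (Fin g)} {γ : List (Fin g)}
    (ht : t ∈ M.transitions) (hact : t.action = .write γ) (htop : t.atTop = true)
    (ρ : List (Fin g)) (hρ : ρ <:+ γ.reverse.tail) (b : List (Fin g)) :
    LabelledPath (elemMachine M.encode).Step {4} ((0, ρ.map Fin.val, t.dst.val), [], b.map Fin.val)
      [] ((0, [], t.dst.val), [], (ρ.reverse ++ b).map Fin.val) := by
  induction ρ generalizing b with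
  | nil => exact .refl _
  | cons X ρ ih =>
    have := ih ((List.suffix_cons X ρ).trans hρ) (X :: b)
    refine .cons_none rfl (.push _ ⟨none, X.val, mem_elemInstrs.2 (.push ht hact htop hρ)⟩) ?_
    simpa using this

/-- The kinds of moves in a segment with the given direction, at the top or below the top. -/
def segmentMode (up top : Bool) : ℕ × ℕ :=
  match up, top with
  | true, true => (1, 4)
  | true, false => (0, 2)
  | false, true => (1, 5)
  | false, false => (0, 3)

theorem segmentMode_mem (up top : Bool) : segmentMode up top ∈ segmentModes := by
  cases up <;> cases top <;> simp [segmentMode, segmentModes]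

theorem segmentMode_fst (up top : Bool) :
    (segmentMode up top).1 = if top = true then 1 else 0 := by
  cases up <;> cases top <;> rfl

/-- A transition is a reading move followed by silent moves. If the head does not change between top
and interior, the silent moves belong to the mode given by its direction. Such a change can only be
upwards onto the top or downwards off the top, which is the last clause. -/
theorem exists_elem_step {t : StackTransition (Fin q) (Fin s) (Fin g)}
    {C C' : StackConfig (Fin q) (Fin s) (Fin g)} (h : M.Step t C C') :
    ∃ c, (elemMachine M.encode).Step (if C.above.isEmpty = true then 1 else 0)
        (t.input.map Fin.val) (elemConfig C) c ∧
      LabelledPath (elemMachine M.encode).Step Set.univ c [] (elemConfig C') ∧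
      (t.action.direction = none → c = elemConfig C' ∧ C'.above.isEmpty = C.above.isEmpty) ∧
      ∀ d, t.action.direction = some d → (C'.above.isEmpty = C.above.isEmpty →
          LabelledPath (elemMachine M.encode).Step {(segmentMode d C.above.isEmpty).2} c []
            (elemConfig C')) ∧
        (C'.above.isEmpty ≠ C.above.isEmpty → C'.above.isEmpty = d) := by
  obtain ⟨p, w, u, b⟩ := C
  obtain ⟨p', w', u', b'⟩ := C'
  obtain ⟨ht, rfl, rfl, -, hb, htop, hm⟩ := h
  simp only at hb htop hm
  obtain ⟨b, rfl⟩ : ∃ b₀, b = t.scanned :: b₀ := by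
    cases b with
    | nil => simp at hb
    | cons Z b => exact ⟨b, by simp at hb; rw [hb]⟩
  have hempty : u.isEmpty = t.atTop := by
    rw [Bool.eq_iff_iff, List.isEmpty_iff, htop]
  have hw : ∀ γ, t.action = .write γ → t.atTop = true := by
    intro γ hγ
    rw [hγ] at hm
    cases hm
    exact htop.2 rfl
  have hread : (elemMachine M.encode).Step (if u.isEmpty = true then 1 else 0)
      (t.input.map Fin.val) ((0, [], t.src.val), u.map Fin.val, (t.scanned :: b).map Fin.val)
      (pendingState t.dst t.action, u.map Fin.val,
        (readSymbol t.scanned t.action :: b).map Fin.val) := by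
    have hmem := mem_elemInstrs.2 (Compiled.read ht hw)
    rw [hempty]
    cases u with
    | nil =>
      rw [htop.2 rfl] at hmem ⊢
      exact .top _ hmem
    | cons Y u =>
      have htop' : t.atTop = false := by simpa using htop
      have hr : readSymbol t.scanned t.action = t.scanned := by
        cases ha : t.action with
        | write γ => simp [hw γ ha] at htop'
        | _ => rfl
      rw [hr] at hmem ⊢
      rw [htop'] at hmem ⊢
      exact .look _ _ _ ⟨_, hmem⟩
  refine ⟨_, hread, ?_⟩
  cases hact : t.action with
  | stay =>
    rw [hact] at hm
    cases hm
    exact ⟨.refl _, fun _ => ⟨rfl, rfl⟩, fun d hd => by simp [StackAction.direction] at hd⟩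
  | down =>
    rw [hact] at hm
    cases hm with
    | down Z Y u b =>
      have hstep : (elemMachine M.encode).Step 3 none
          ((1, [], t.dst.val), u.map Fin.val, (t.scanned :: Y :: b).map Fin.val)
          ((0, [], t.dst.val), (t.scanned :: u).map Fin.val, (Y :: b).map Fin.val) :=
        .down _ _ _ _ ⟨none, 0, 0, mem_elemInstrs.2 (.down ht hw)⟩
      refine ⟨.cons_none (Set.mem_univ _) hstep (.refl _),
        fun h => by simp [StackAction.direction] at h, fun d hd => ?_⟩
      obtain rfl : false = d := by simpa [StackAction.direction] using hd
      refine ⟨fun h => ?_, fun _ => rfl⟩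
      obtain hu : u.isEmpty = false := h.symm
      rw [hu]
      exact .cons_none rfl hstep (.refl _)
  | up =>
    rw [hact] at hm
    cases hm with
    | up Z Y u b =>
      have hstep : (elemMachine M.encode).Step 2 none
          ((2, [], t.dst.val), (Y :: u').map Fin.val, (t.scanned :: b).map Fin.val)
          ((0, [], t.dst.val), u'.map Fin.val, (Y :: t.scanned :: b).map Fin.val) :=
        .up _ _ _ _ ⟨none, 0, 0, mem_elemInstrs.2 (.up ht hw)⟩
      refine ⟨.cons_none (Set.mem_univ _) hstep (.refl _),
        fun h => by simp [StackAction.direction] at h, fun d hd => ?_⟩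
      obtain rfl : true = d := by simpa [StackAction.direction] using hd
      exact ⟨fun h => .cons_none rfl hstep (.refl _), fun h => by simpa using h⟩
  | write γ =>
    rw [hact] at hm
    cases hm with
    | write Z γ b =>
      cases γ with
      | nil =>
        have hstep : (elemMachine M.encode).Step 5 none
            ((3, [], t.dst.val), [], (t.scanned :: b).map Fin.val)
            ((0, [], t.dst.val), [], b.map Fin.val) :=
          .pop _ ⟨none, 0, mem_elemInstrs.2 (.pop ht hw)⟩
        refine ⟨.cons_none (Set.mem_univ _) hstep (.refl _),
          fun h => by simp [StackAction.direction] at h, fun d hd => ?_⟩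
        obtain rfl : false = d := by simpa [StackAction.direction] using hd
        exact ⟨fun h => .cons_none rfl hstep (.refl _), fun h => absurd rfl h⟩
      | cons X γ =>
        have hpush := push_path ht hact (htop.2 rfl) _ List.suffix_rfl
          (readSymbol t.scanned (.write (X :: γ)) :: b)
        have hγ : (X :: γ).reverse.tail.reverse ++
            readSymbol t.scanned (.write (X :: γ)) :: b = X :: γ ++ b := by
          rcases List.eq_nil_or_concat (X :: γ) with h' | ⟨γ', Y, h'⟩
          · simp at h'
          · rw [h']; simp [readSymbol]
        rw [hγ] at hpush
        refine ⟨hpush.mono (Set.subset_univ _), fun h => ?_, fun d hd => ?_⟩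
        · cases γ with
          | nil => exact ⟨rfl, rfl⟩
          | cons Y γ => simp [StackAction.direction] at h
        · cases γ with
          | nil => simp [StackAction.direction] at hd
          | cons Y γ =>
            obtain rfl : true = d := by simpa [StackAction.direction] using hd
            exact ⟨fun _ => hpush, fun h => absurd rfl h⟩

/-- Words that consist of at most `n` words read in segments. -/
def SegmentWords (M : StackAutomaton (Fin q) (Fin s) (Fin g)) (n : ℕ) (y : List ℕ) : Prop :=
  ∃ xs : List (List ℕ), xs.length ≤ n ∧ xs.flatten = y ∧
    ∀ x ∈ xs, ∃ m ∈ segmentModes, x ∈ (elemMachine M.encode).segmentLang {m.1, m.2}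

theorem SegmentWords.mono {n n' : ℕ} (hn : n ≤ n') {y : List ℕ} (h : M.SegmentWords n y) :
    M.SegmentWords n' y := by
  obtain ⟨xs, h₁, h₂⟩ := h
  exact ⟨xs, h₁.trans hn, h₂⟩

/-- The input that remains in `C` can be read in a segment of the mode `m` and `n` more segments. -/
def Segmented (M : StackAutomaton (Fin q) (Fin s) (Fin g)) (m : ℕ × ℕ) (n : ℕ)
    (C : StackConfig (Fin q) (Fin s) (Fin g)) : Prop :=
  ∃ x y c, C.input.map Fin.val = x ++ y ∧
    LabelledPath (elemMachine M.encode).Step {m.1, m.2} (elemConfig C) x c ∧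
    (elemMachine M.encode).CoReach c ∧ M.SegmentWords n y

theorem Segmented.coReach {m : ℕ × ℕ} {n : ℕ} {C : StackConfig (Fin q) (Fin s) (Fin g)}
    (h : M.Segmented m n C) : (elemMachine M.encode).CoReach (elemConfig C) := by
  obtain ⟨x, y, c, -, h₁, h₂, -⟩ := h
  exact (reflTransGen_of_path h₁).trans h₂

theorem Segmented.segmentWords {m : ℕ × ℕ} (hm : m ∈ segmentModes) {n : ℕ}
    {C : StackConfig (Fin q) (Fin s) (Fin g)} (h : M.Segmented m n C)
    (hC : (elemMachine M.encode).Reach (elemConfig C)) :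
    M.SegmentWords (n + 1) (C.input.map Fin.val) := by
  obtain ⟨x, y, c, h₁, h₂, h₃, xs, h₄, h₅, h₆⟩ := h
  refine ⟨x :: xs, by simpa using h₄, by rw [h₁, List.flatten_cons, h₅], ?_⟩
  simp only [List.mem_cons, forall_eq_or_imp]
  exact ⟨⟨m, hm, _, _, hC, h₂, h₃⟩, h₆⟩

/-- The default value `d` expresses that a last movement is not followed by a change. -/
theorem directionChanges_cons (d : Bool) (ds : List Bool) :
    directionChanges (d :: ds) = (if ds.head?.getD d = d then 0 else 1) + directionChanges ds := by
  cases ds with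
  | nil => simp [directionChanges]
  | cons e ds => simp [directionChanges, eq_comm]

/-- The bound is on the segments after the current one. Within one direction the head can still
change between top and interior only if it is inside and moving up or at the top and moving down,
that is, if `d ≠ C.above.isEmpty`; this is the extra 1. Each change of direction costs at most 2. -/
theorem Run.segmented {C C' : StackConfig (Fin q) (Fin s) (Fin g)} {ds : List Bool}
    (h : M.Run C ds C') (hin : C'.input = []) (hfin : C'.state ∈ M.final)
    (hinv : C.above = [] ∨ C.below ≠ []) (hC : (elemMachine M.encode).Reach (elemConfig C))
    (d : Bool) (hd : ∀ e ∈ ds.head?, e = d) :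
    M.Segmented (segmentMode d C.above.isEmpty)
      (2 * directionChanges ds + if d = C.above.isEmpty then 0 else 1) C := by
  induction h generalizing d with
  | refl C => exact ⟨[], [], elemConfig C, by simp [hin], .refl _, coReach_of_final hfin hinv,
      [], by simp, rfl, by simp⟩
  | @step C C₁ C₂ t ds hs hr ih =>
    obtain ⟨c, h₁, h₂, h₃, h₄⟩ := exists_elem_step hs
    have hinput : C.input.map Fin.val = (t.input.map Fin.val).toList ++ C₁.input.map Fin.val := by
      rw [hs.2.2.2.1, List.map_append]
      cases t.input <;> rfl
    have hinv₁ : C₁.above = [] ∨ C₁.below ≠ [] := by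
      have hm := hs.2.2.2.2.2.2
      generalize t.action = act at hm
      generalize C.above = u, C.below = b at hm
      obtain ⟨_, _, u', b'⟩ := C₁
      simp only at hm ⊢
      cases hm <;> simp
    have hC₁ : (elemMachine M.encode).Reach (elemConfig C₁) :=
      (hC.tail h₁.move).trans (reflTransGen_of_path h₂)
    specialize ih hin hfin hinv₁ hC₁
    have hfst : ∀ e, (if C.above.isEmpty = true then 1 else 0) ∈
        ({(segmentMode e C.above.isEmpty).1, (segmentMode e C.above.isEmpty).2} : Set ℕ) :=
      fun e => .inl (segmentMode_fst e _).symm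
    cases hdir : t.action.direction with
    | none =>
      rw [hdir] at hd
      obtain ⟨rfl, htop⟩ := h₃ hdir
      obtain ⟨x, y, c', h₅, h₆, h₇, h₈⟩ := ih d hd
      rw [htop] at h₆ h₈
      exact ⟨_ ++ x, y, c', by rw [hinput, h₅, List.append_assoc], .cons (hfst d) h₁ h₆, h₇, h₈⟩
    | some e =>
      rw [hdir] at hd
      obtain rfl : e = d := hd e rfl
      obtain ⟨h₅, h₆⟩ := h₄ e hdir
      -- The next direction decides the mode of what follows; if the head does not move any more,
      -- the current direction is kept.
      have hIH := ih (ds.head?.getD e) (by cases ds <;> simp)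
      simp only [Option.toList_some, List.cons_append, List.nil_append, directionChanges_cons]
      by_cases hsame : ds.head?.getD e = e ∧ C₁.above.isEmpty = C.above.isEmpty
      · obtain ⟨x, y, c', h₇, h₈, h₉, h₀⟩ := hIH
        rw [hsame.1, hsame.2] at h₈ h₀
        refine ⟨_ ++ x, y, c', by rw [hinput, h₇, List.append_assoc],
          .cons (hfst e) h₁ (((h₅ hsame.2).mono ?_).trans h₈), h₉, ?_⟩
        · intro k hk
          exact .inr hk
        · simpa [hsame.1] using h₀
      -- The current segment ends right after the reading move; the silent moves belong to no
      -- segment.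
      · refine ⟨_, _, c, hinput, .single (hfst e) h₁, (reflTransGen_of_path h₂).trans hIH.coReach,
          (hIH.segmentWords (segmentMode_mem _ _) hC₁).mono ?_⟩
        by_cases hne : ds.head?.getD e = e
        · have hne' : C₁.above.isEmpty ≠ C.above.isEmpty := fun h => hsame ⟨hne, h⟩
          -- After this change the direction agrees with the position, so the extra 1 is spent on
          -- the new segment.
          have h₇ := h₆ hne'
          have h₈ : e ≠ C.above.isEmpty := fun h => hne' (h₇.trans h)
          rw [hne, if_pos h₇.symm, if_neg h₈]
          simp
        -- The 2 counted for the change of direction pays for the new segment and for one later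
        -- change between top and interior.
        · rw [if_neg hne]
          split_ifs <;> omega

theorem AcceptsWith.segmentWords {w : List (Fin s)} {ds : List Bool} (h : M.AcceptsWith w ds) :
    M.SegmentWords (2 * directionChanges ds + 2) (w.map Fin.val) := by
  obtain ⟨C, h₁, h₂, h₃⟩ := h
  have hC : (elemMachine M.encode).Reach (elemConfig (M.initial w)) :=
    .single (Step.push (M := elemMachine M.encode) (p := (4, [], 0)) []
      ⟨none, 0, mem_elemInstrs.2 .start⟩).move
  have := h₁.segmented h₂ h₃ (.inl rfl) hC (ds.head?.getD true) (by cases ds <;> simp)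
  refine (this.segmentWords (segmentMode_mem _ _) hC).mono ?_
  split_ifs <;> omega

theorem mem_language_of_path {w : List ℕ}
    (h : LabelledPath (elemMachine M.encode).Step Set.univ ((4, [], 0), [], []) w
      ((5, [], 0), [], [])) : ∃ v ∈ M.language, v.map Fin.val = w := by
  obtain ⟨v, ds, C, h₁, h₂, h₃⟩ := (decoded_of_path h rfl [] [] rfl rfl).2.2.2.2 rfl rfl rfl
  exact ⟨v, ⟨ds, C, h₂, h₃⟩, h₁⟩

end StackAutomaton

/-! ### Pigeonhole on segments and the characterization of density -/

/-- The border between `z` and `y` lies either left or right of the border between `x` and `r`. -/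
theorem List.infix_or_infix_of_append {A : Type*} {x y z r : List A}
    (h : z ++ y <:+: x ++ r) : z <:+: x ∨ y <:+: r := by
  obtain ⟨a, b, h⟩ := h
  rw [show a ++ (z ++ y) ++ b = (a ++ z) ++ (y ++ b) by simp, List.append_eq_append_iff] at h
  rcases h with ⟨e, rfl, -⟩ | ⟨e, -, rfl⟩
  · exact .inl ⟨a, e, by simp⟩
  · exact .inr ⟨e, b, by simp⟩

/-- Either the first factor contains a copy of `z`, or all copies but the first lie in the remaining
factors. -/
theorem List.exists_infix_of_flatten_replicate {A : Type*} {z : List A} (hz : z ≠ []) (n : ℕ)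
    (xs : List (List A)) (hn : xs.length < n) (h : (List.replicate n z).flatten <:+: xs.flatten) :
    ∃ x ∈ xs, z <:+: x := by
  induction xs generalizing n with
  | nil =>
    obtain ⟨n, rfl⟩ := Nat.exists_eq_succ_of_ne_zero hn.ne'
    simp [List.replicate_succ, hz] at h
  | cons x xs ih =>
    obtain ⟨n, rfl⟩ := Nat.exists_eq_succ_of_ne_zero (Nat.ne_of_gt (Nat.zero_lt_of_lt hn))
    rw [List.replicate_succ, List.flatten_cons, List.flatten_cons] at h
    rcases List.infix_or_infix_of_append h with h | h
    · exact ⟨x, List.mem_cons_self, h⟩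
    · obtain ⟨x', hx', h⟩ := ih n (by simpa using hn) h
      exact ⟨x', List.mem_cons_of_mem _ hx', h⟩

namespace StackAutomaton

variable {q s g : ℕ} {M : StackAutomaton (Fin q) (Fin s) (Fin g)}

theorem mem_segmentLang_of_infix {M : ElemMachine ElemState ℕ ℕ} {κ : Set ℕ} {v w : List ℕ}
    (h : w <:+: v) (hv : v ∈ M.segmentLang κ) : w ∈ M.segmentLang κ := by
  obtain ⟨x, y, rfl⟩ := h
  exact segmentLang_infix hv

/-- The language of a reversal-bounded automaton is dense if and only if every word can be read in
a segment of one of the four modes. -/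
theorem dense_iff (hM : M.ReversalBounded) : DenseLanguage M.language ↔
    ∃ m ∈ segmentModes, ∀ w : List (Fin s),
      w.map Fin.val ∈ (elemMachine M.encode).segmentLang {m.1, m.2} := by
  constructor
  · intro h
    have hdense : ∀ y, ∃ w ∈ M.language, y <:+: w := fun y =>
      (Set.ext_iff.1 h y).2 (Set.mem_univ y)
    obtain ⟨k, hk⟩ := hM
    by_contra hno
    push Not at hno
    choose! f hf using hno
    -- Density provides an accepting computation, so the empty word is in every segment language.
    -- This makes the concatenation of the missing words nonempty, as the pigeonhole lemma needs.
    have hmem : ∀ m ∈ segmentModes, f m ≠ [] := by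
      intro m hm h0
      refine hf m hm ?_
      rw [h0]
      obtain ⟨w, ⟨ds, hw⟩, -⟩ := hdense []
      obtain ⟨C, h₁, h₂, h₃⟩ := hw
      have hC : (elemMachine M.encode).Reach (elemConfig (M.initial w)) :=
        .single (Step.push (M := elemMachine M.encode) (p := (4, [], 0)) []
          ⟨none, 0, mem_elemInstrs.2 .start⟩).move
      have := h₁.segmented h₂ h₃ (.inl rfl) hC (ds.head?.getD true) (by cases ds <;> simp)
      exact ⟨_, _, hC, .refl _, this.coReach⟩
    have hz : (segmentModes.flatMap f) ≠ [] := by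
      simp only [segmentModes, List.flatMap_cons]
      have := hmem (1, 4) (by simp [segmentModes])
      simp [this]
    obtain ⟨w, ⟨ds, hw⟩, hinf⟩ :=
      -- One copy more than the `2 * k + 2` segments that `k` direction changes allow.
      hdense (List.replicate (2 * k + 3) (segmentModes.flatMap f)).flatten
    obtain ⟨xs, h₁, h₂, h₃⟩ := hw.segmentWords
    have hlen : xs.length < 2 * k + 3 := by have := hk w ds hw; omega
    have hinf' := hinf.map Fin.val
    rw [← h₂, List.map_flatten, List.map_replicate] at hinf'
    obtain ⟨x, hx, hx'⟩ := List.exists_infix_of_flatten_replicate (by simpa using hz) _ _ hlen hinf'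
    obtain ⟨m, hm, hxm⟩ := h₃ x hx
    refine hf m hm (mem_segmentLang_of_infix (List.IsInfix.trans ?_ hx') hxm)
    exact (List.infix_of_mem_flatten (List.mem_map_of_mem hm)).map _
  · rintro ⟨m, -, hm⟩
    refine Set.eq_univ_of_forall fun y => ?_
    obtain ⟨c, c', h₁, h₂, h₃⟩ := hm y
    obtain ⟨x, hx⟩ := exists_path h₁
    obtain ⟨z, hz⟩ := exists_path h₃
    obtain ⟨v, hv, hvw⟩ := mem_language_of_path
      ((hx.trans (h₂.mono (Set.subset_univ _))).trans hz)
    refine ⟨v, hv, ?_⟩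
    obtain ⟨v₁, z', rfl, h₄, -⟩ := List.map_eq_append_iff.1 hvw
    obtain ⟨x', y', rfl, -, h₅⟩ := List.map_eq_append_iff.1 h₄
    obtain rfl := (List.map_injective_iff.2 Fin.val_injective) h₅
    exact ⟨x', z', rfl⟩

end StackAutomaton

/-! ### Primitive recursiveness by `fun_prop` -/

section Primrec

attribute [fun_prop] Primrec PrimrecPred Primrec.id Primrec.const Primrec.comp Primrec.pair

variable {α β γ σ : Type*} [Primcodable α] [Primcodable β] [Primcodable γ] [Primcodable σ]

namespace Primrec

@[fun_prop]
theorem fun_fst {f : α → β × γ} (hf : Primrec f) : Primrec fun a => (f a).1 := fst.comp hf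

@[fun_prop]
theorem fun_snd {f : α → β × γ} (hf : Primrec f) : Primrec fun a => (f a).2 := snd.comp hf

@[fun_prop]
theorem fun_some {f : α → β} (hf : Primrec f) : Primrec fun a => some (f a) :=
  option_some.comp hf

@[fun_prop]
theorem fun_getD {f : α → Option β} {g : α → β} (hf : Primrec f) (hg : Primrec g) :
    Primrec fun a => (f a).getD (g a) := option_getD.comp hf hg

@[fun_prop]
theorem fun_ite {p : α → Prop} [DecidablePred p] {f g : α → β} (hp : PrimrecPred p)
    (hf : Primrec f) (hg : Primrec g) : Primrec fun a => if p a then f a else g a :=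
  ite hp hf hg

@[fun_prop]
theorem fun_cons {f : α → β} {g : α → List β} (hf : Primrec f) (hg : Primrec g) :
    Primrec fun a => f a :: g a := list_cons.comp hf hg

@[fun_prop]
theorem fun_append {f g : α → List β} (hf : Primrec f) (hg : Primrec g) :
    Primrec fun a => f a ++ g a := list_append.comp hf hg

@[fun_prop]
theorem fun_reverse {f : α → List β} (hf : Primrec f) : Primrec fun a => (f a).reverse :=
  list_reverse.comp hf

@[fun_prop]
theorem fun_head? {f : α → List β} (hf : Primrec f) : Primrec fun a => (f a).head? :=
  list_head?.comp hf

@[fun_prop]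
theorem fun_tail {f : α → List β} (hf : Primrec f) : Primrec fun a => (f a).tail :=
  list_tail.comp hf

@[fun_prop]
theorem fun_length {f : α → List β} (hf : Primrec f) : Primrec fun a => (f a).length :=
  list_length.comp hf

@[fun_prop]
theorem fun_getElem? {f : α → List β} {g : α → ℕ} (hf : Primrec f) (hg : Primrec g) :
    Primrec fun a => (f a)[g a]? := list_getElem?.comp hf hg

@[fun_prop]
theorem fun_range {f : α → ℕ} (hf : Primrec f) : Primrec fun a => List.range (f a) :=
  list_range.comp hf

@[fun_prop]
theorem fun_map {f : α → List β} {g : α → β → γ} (hf : Primrec f)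
    (hg : Primrec fun x : α × β => g x.1 x.2) : Primrec fun a => (f a).map (g a) :=
  list_map hf hg

@[fun_prop]
theorem fun_flatMap {f : α → List β} {g : α → β → List γ} (hf : Primrec f)
    (hg : Primrec fun x : α × β => g x.1 x.2) : Primrec fun a => (f a).flatMap (g a) :=
  list_flatMap hf hg

@[fun_prop]
theorem fun_add {f g : α → ℕ} (hf : Primrec f) (hg : Primrec g) : Primrec fun a => f a + g a :=
  nat_add.comp hf hg

@[fun_prop]
theorem fun_mul {f g : α → ℕ} (hf : Primrec f) (hg : Primrec g) : Primrec fun a => f a * g a :=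
  nat_mul.comp hf hg

@[fun_prop]
theorem fun_pow {f g : α → ℕ} (hf : Primrec f) (hg : Primrec g) : Primrec fun a => f a ^ g a :=
  (Primrec₂.unpaired'.1 Nat.Primrec.pow).comp hf hg

end Primrec

namespace PrimrecPred

open Primrec

@[fun_prop]
theorem fun_and {p q : α → Prop} (hp : PrimrecPred p) (hq : PrimrecPred q) :
    PrimrecPred fun a => p a ∧ q a := hp.and hq

@[fun_prop]
theorem fun_or {p q : α → Prop} (hp : PrimrecPred p) (hq : PrimrecPred q) :
    PrimrecPred fun a => p a ∨ q a := hp.or hq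

@[fun_prop]
theorem fun_not {p : α → Prop} (hp : PrimrecPred p) : PrimrecPred fun a => ¬ p a := hp.not

@[fun_prop]
theorem fun_eq {f g : α → β} (hf : Primrec f) (hg : Primrec g) : PrimrecPred fun a => f a = g a :=
  Primrec.eq.comp hf hg

@[fun_prop]
theorem fun_ne {f g : α → β} (hf : Primrec f) (hg : Primrec g) : PrimrecPred fun a => f a ≠ g a :=
  (fun_eq hf hg).not

@[fun_prop]
theorem fun_lt {f g : α → ℕ} (hf : Primrec f) (hg : Primrec g) : PrimrecPred fun a => f a < g a :=
  nat_lt.comp hf hg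

@[fun_prop]
theorem exists_mem {f : α → List β} {p : α → β → Prop} (hf : Primrec f)
    (hp : PrimrecPred fun x : α × β => p x.1 x.2) : PrimrecPred fun a => ∃ b, b ∈ f a ∧ p a b :=
  (PrimrecRel.exists_mem_list (R := fun b a => p a b) (hp.comp (pair snd fst))).comp hf Primrec.id

@[fun_prop]
theorem mem {f : α → β} {g : α → List β} (hf : Primrec f) (hg : Primrec g) :
    PrimrecPred fun a => f a ∈ g a :=
  (exists_mem hg (p := fun a b => b = f a) (by fun_prop)).of_eq (by simp)

end PrimrecPred

/-- Bounded universal quantifiers, after implications have become disjunctions, are brought into the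
form that `PrimrecPred.exists_mem` and `PrimrecPred.fun_not` handle. -/
theorem forall_notMem_or {β : Type*} (l : List β) (p : β → Prop) :
    (∀ b, b ∉ l ∨ p b) ↔ ¬ ∃ b, b ∈ l ∧ ¬ p b := by
  simp only [not_exists, not_and_not_right, imp_iff_not_or]

end Primrec

namespace ElemMachine

@[fun_prop]
theorem primrec_witnessBound {α : Type*} [Primcodable α] {f g : α → ℕ} (hf : Primrec f)
    (hg : Primrec g) : Primrec fun a => witnessBound (f a) (g a) := by
  unfold witnessBound
  fun_prop

variable {α S : Type*} [Primcodable α] [Primcodable S]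

@[fun_prop]
theorem primrec_segmentList {w : α → List ℕ} {m : α → ℕ × ℕ} {L : α → List (Instr S)}
    (hw : Primrec w) (hm : Primrec m) (hL : Primrec L) :
    Primrec fun a => segmentList (w a) (m a) (L a) := by
  unfold segmentList
  fun_prop

@[fun_prop]
theorem primrecPred_refutes {L : α → List (Instr S)} {st fn : α → S} {t : α → Table S}
    (hL : Primrec L) (hst : Primrec st) (hfn : Primrec fn) (ht : Primrec t) :
    PrimrecPred fun a => Refutes (L a) (st a) (fn a) (t a) := by
  unfold Refutes InstrClosed
  simp only [imp_iff_not_or, forall_notMem_or]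
  fun_prop

end ElemMachine

theorem primrec_pushInstrs : Primrec₂ pushInstrs := by
  refine (Primrec.list_rec Primrec.fst (Primrec.const [])
    (h := fun x y => (4, (0, y.1 :: y.2.1, x.2), none, y.1, y.1, (0, y.2.1, x.2)) :: y.2.2)
    (by unfold Primrec₂; fun_prop)).of_eq fun x => ?_
  obtain ⟨ρ, p⟩ := x
  induction ρ with
  | nil => rfl
  | cons X ρ ih => simp [pushInstrs, ← ih]

@[fun_prop]
theorem primrec_fun_pushInstrs {α : Type*} [Primcodable α] {f : α → List ℕ} {g : α → ℕ}
    (hf : Primrec f) (hg : Primrec g) : Primrec fun a => pushInstrs (f a) (g a) :=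
  primrec_pushInstrs.comp hf hg

@[fun_prop]
theorem primrec_elemInstrs : Primrec elemInstrs := by
  unfold elemInstrs transitionInstrs
  fun_prop

/-! ### Finite certificates for acceptance -/

namespace ElemMachine

variable {S : Type*}

/-- The instruction `e` leads from `c` to `c'`. -/
def MoveBy (e : Instr S) (c c' : S × List ℕ × List ℕ) : Prop :=
  e.2.1 = c.1 ∧ e.2.2.2.2.2 = c'.1 ∧
  (e.1 = 0 ∧ c.2.1 ≠ [] ∧ c.2.2.head? = some e.2.2.2.1 ∧ c'.2 = c.2 ∨
    e.1 = 1 ∧ c.2.1 = [] ∧ c.2.2.head? = some e.2.2.2.1 ∧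
      c'.2 = ([], e.2.2.2.2.1 :: c.2.2.tail) ∨
    e.1 = 2 ∧ c.2.1 ≠ [] ∧ c.2.2 ≠ [] ∧ c.2.1.head? = c'.2.2.head? ∧ c'.2.1 = c.2.1.tail ∧
      c'.2.2.tail = c.2.2 ∨
    e.1 = 3 ∧ c'.2.1 ≠ [] ∧ c'.2.2 ≠ [] ∧ c'.2.1.head? = c.2.2.head? ∧ c.2.1 = c'.2.1.tail ∧
      c.2.2.tail = c'.2.2 ∨
    e.1 = 4 ∧ c.2.1 = [] ∧ c'.2 = ([], e.2.2.2.2.1 :: c.2.2) ∨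
    e.1 = 5 ∧ c.2.1 = [] ∧ c'.2.1 = [] ∧ c.2.2 = e.2.2.2.1 :: c'.2.2)

theorem move_ofList {L : List (Instr S)} {start fin : S} {c c' : S × List ℕ × List ℕ} :
    (ofList L start fin).Move c c' ↔ ∃ e ∈ L, MoveBy e c c' := by
  constructor
  · rintro ⟨k, a, h⟩
    cases h with
    | look Y u b h =>
      obtain ⟨Y, h⟩ := h
      exact ⟨_, h, by simp [MoveBy]⟩
    | top b h => exact ⟨_, h, by simp [MoveBy]⟩
    | up Z Y u b h =>
      obtain ⟨a, Z, Y, h⟩ := h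
      exact ⟨_, h, by simp [MoveBy]⟩
    | down Z Y u b h =>
      obtain ⟨a, Z, Y, h⟩ := h
      exact ⟨_, h, by simp [MoveBy]⟩
    | push b h =>
      obtain ⟨a, Z, h⟩ := h
      exact ⟨_, h, by simp [MoveBy]⟩
    | pop b h =>
      obtain ⟨a, Y, h⟩ := h
      exact ⟨_, h, by simp [MoveBy]⟩
  · rintro ⟨⟨k, p, a, Z, Y, q⟩, he, h⟩
    obtain ⟨p', u, b⟩ := c
    obtain ⟨q', u', b'⟩ := c'
    obtain ⟨h₁, h₂, h⟩ := h
    simp only at h₁ h₂ h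
    subst h₁ h₂
    rcases h with ⟨rfl, h₁, h₂, h₃⟩ | ⟨rfl, rfl, h₂, h₃⟩ | ⟨rfl, h₁, h₂, h₃, h₄, h₅⟩ |
      ⟨rfl, h₁, h₂, h₃, h₄, h₅⟩ | ⟨rfl, rfl, h₂⟩ | ⟨rfl, rfl, rfl, rfl⟩
    · obtain ⟨rfl, rfl⟩ := Prod.mk.injEq .. ▸ h₃
      obtain ⟨Y', u, rfl⟩ := List.exists_cons_of_ne_nil h₁
      obtain ⟨b, rfl⟩ := List.head?_eq_some_iff.1 h₂
      exact (Step.look (M := ofList L start fin) Y' u b ⟨Y, he⟩).move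
    · obtain ⟨rfl, rfl⟩ := Prod.mk.injEq .. ▸ h₃
      obtain ⟨b, rfl⟩ := List.head?_eq_some_iff.1 h₂
      exact (Step.top (M := ofList L start fin) b he).move
    · obtain ⟨Y', u, rfl⟩ := List.exists_cons_of_ne_nil h₁
      obtain ⟨Z', b, rfl⟩ := List.exists_cons_of_ne_nil h₂
      obtain ⟨b₁, rfl⟩ := List.head?_eq_some_iff.1 h₃.symm
      simp only [List.tail_cons] at h₄ h₅
      subst h₄ h₅
      exact (Step.up (M := ofList L start fin) Z' Y' _ b ⟨a, Z, Y, he⟩).move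
    · obtain ⟨Y', u, rfl⟩ := List.exists_cons_of_ne_nil h₁
      obtain ⟨Z', b, rfl⟩ := List.exists_cons_of_ne_nil h₂
      obtain ⟨b₁, rfl⟩ := List.head?_eq_some_iff.1 h₃.symm
      simp only [List.tail_cons] at h₄ h₅
      subst h₄ h₅
      exact (Step.down (M := ofList L start fin) Z' Y' _ b ⟨a, Z, Y, he⟩).move
    · obtain ⟨rfl, rfl⟩ := Prod.mk.injEq .. ▸ h₂
      exact (Step.push (M := ofList L start fin) b ⟨a, Z, he⟩).move
    · exact (Step.pop (M := ofList L start fin) b' ⟨a, Y, he⟩).move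

/-- The list `D` of numbered configurations shows that `ofList L start fin` has an accepting
computation: each of them accepts or has a successor in `D` with a smaller number. -/
def Certifies (L : List (Instr S)) (start fin : S) (D : List (ℕ × S × List ℕ × List ℕ)) : Prop :=
  (∃ x, x ∈ D ∧ x.2 = (start, [], [])) ∧
  ∀ x ∈ D, x.2 = (fin, [], []) ∨ ∃ y, y ∈ D ∧ y.1 < x.1 ∧ ∃ e, e ∈ L ∧ MoveBy e x.2 y.2

/-- The numbers decrease along successors, so following them must end in the accepting
configuration. Conversely, an accepting computation is numbered from its end. -/
theorem coReach_iff_exists_certifies {L : List (Instr S)} {start fin : S} :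
    (ofList L start fin).CoReach (start, [], []) ↔ ∃ D, Certifies L start fin D := by
  constructor
  · suffices ∀ c, (ofList L start fin).CoReach c → ∃ D : List (ℕ × S × List ℕ × List ℕ),
        (∃ x, x ∈ D ∧ x.2 = c) ∧ ∀ x ∈ D, x.2 = (fin, [], []) ∨
          ∃ y, y ∈ D ∧ y.1 < x.1 ∧ ∃ e, e ∈ L ∧ MoveBy e x.2 y.2 from this _
    intro c h
    induction h using Relation.ReflTransGen.head_induction_on with
    | refl => exact ⟨[(0, fin, [], [])], ⟨_, List.mem_cons_self, rfl⟩, by simp⟩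
    | @head c c' h _ ih =>
      obtain ⟨D, ⟨x, hx, rfl⟩, hD⟩ := ih
      refine ⟨(x.1 + 1, c) :: D, ⟨_, List.mem_cons_self, rfl⟩, ?_⟩
      rintro y (_ | ⟨_, hy⟩)
      · exact .inr ⟨x, List.mem_cons_of_mem _ hx, Nat.lt_succ_self _, move_ofList.1 h⟩
      · exact (hD y hy).imp_right fun ⟨z, hz, h⟩ => ⟨z, List.mem_cons_of_mem _ hz, h⟩
  · rintro ⟨D, ⟨x, hx, hxs⟩, hD⟩
    rw [← hxs]
    clear hxs
    induction hn : x.1 using Nat.strong_induction_on generalizing x with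
    | _ n ih =>
      obtain h | ⟨y, hy, hlt, h⟩ := hD x hx
      · rw [h]
        exact .refl
      · exact .head (move_ofList.2 h) (ih y.1 (hn ▸ hlt) y hy rfl)

@[fun_prop]
theorem primrecPred_certifies {α : Type*} [Primcodable α] [Primcodable S] {L : α → List (Instr S)}
    {st fn : α → S} {D : α → List (ℕ × S × List ℕ × List ℕ)} (hL : Primrec L) (hst : Primrec st)
    (hfn : Primrec fn) (hD : Primrec D) :
    PrimrecPred fun a => Certifies (L a) (st a) (fn a) (D a) := by
  unfold Certifies MoveBy
  simp only [imp_iff_not_or, forall_notMem_or]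
  fun_prop

end ElemMachine

/-! ### Evidence for and against density, and the search for it -/

/-- Evidence for density: a mode, and words with certificates that they are read in a segment of
this mode. -/
abbrev DenseEvidence : Type :=
  (ℕ × ℕ) × List (List ℕ × List (ℕ × (ℕ × ElemState) × List ℕ × List ℕ))

/-- Evidence against density: for each mode, a word with a table showing that it is not read in a
segment of this mode. -/
abbrev NondenseEvidence : Type :=
  List ((ℕ × ℕ) × List ℕ × Table (ℕ × ElemState))

/-- The evidence shows that the language is dense. -/
def ShowsDense (c : StackAutomatonCode) (E : DenseEvidence) : Prop :=
  E.1 ∈ segmentModes ∧ (∃ x, x ∈ E.2 ∧ x.1 = []) ∧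
  ∀ x ∈ E.2,
    Certifies (segmentList x.1 E.1 (elemInstrs c)) (0, (4, [], 0)) (x.1.length, (5, [], 0)) x.2 ∧
    (x.1.length < witnessBound (2 * (elemInstrs c).length + 2) (elemInstrs c).length →
      ∀ a ∈ List.range c.2.1, ∃ y, y ∈ E.2 ∧ y.1 = a :: x.1)

/-- The evidence shows that the language is not dense. -/
def ShowsNondense (c : StackAutomatonCode) (N : NondenseEvidence) : Prop :=
  ∀ m ∈ segmentModes, ∃ x, x ∈ N ∧ x.1 = m ∧ (∀ a ∈ x.2.1, a < c.2.1) ∧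
    Refutes (segmentList x.2.1 m (elemInstrs c)) (0, (4, [], 0)) (x.2.1.length, (5, [], 0)) x.2.2

@[fun_prop]
theorem primrecPred_showsDense {α : Type*} [Primcodable α] {c : α → StackAutomatonCode}
    {e : α → DenseEvidence} (hc : Primrec c) (he : Primrec e) :
    PrimrecPred fun a => ShowsDense (c a) (e a) := by
  unfold ShowsDense
  simp only [imp_iff_not_or, forall_notMem_or]
  fun_prop

@[fun_prop]
theorem primrecPred_showsNondense {α : Type*} [Primcodable α] {c : α → StackAutomatonCode}
    {e : α → NondenseEvidence} (hc : Primrec c) (he : Primrec e) :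
    PrimrecPred fun a => ShowsNondense (c a) (e a) := by
  unfold ShowsNondense
  simp only [imp_iff_not_or, forall_notMem_or]
  fun_prop

namespace StackAutomaton

variable {q s g : ℕ} {M : StackAutomaton (Fin q) (Fin s) (Fin g)}

/-- The list of words contains the empty word and is closed under prepending letters up to the
bound, so it contains all words up to that length. If some word were missing from the segment
language, a missing one would be among them. -/
theorem exists_showsDense_iff (hM : M.ReversalBounded) :
    (∃ E, ShowsDense M.encode E) ↔ DenseLanguage M.language := by
  rw [dense_iff hM]
  constructor
  · rintro ⟨⟨m, E⟩, hm, ⟨x, hx, hx0⟩, hE⟩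
    refine ⟨m, hm, fun w => ?_⟩
    by_contra hw
    obtain ⟨w, hw, hlen⟩ := exists_short_notMem_ofList _ _ _ Fin.val hm hw
    refine hw ?_
    suffices ∃ y ∈ E, y.1 = w.map Fin.val by
      obtain ⟨y, hy, hyw⟩ := this
      exact hyw ▸ (segmentList_coReach_iff hm _ _ _).1 (coReach_iff_exists_certifies.2
        ⟨_, (hE y hy).1⟩)
    clear hw
    induction w with
    | nil => exact ⟨x, hx, hx0⟩
    | cons a w ih =>
      obtain ⟨y, hy, hyw⟩ := ih (by simp only [List.length_cons] at hlen; omega)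
      exact (hE y hy).2 (by simpa [hyw] using hlen) a (List.mem_range.2 a.isLt) |>.imp
        fun z hz => ⟨hz.1, by simpa [hyw] using hz.2⟩
  · rintro ⟨m, hm, h⟩
    have h' : ∀ w : List (Fin s), ∃ D, Certifies (segmentList (w.map Fin.val) m
        (elemInstrs M.encode)) (0, (4, [], 0)) ((w.map Fin.val).length, (5, [], 0)) D :=
      fun w => coReach_iff_exists_certifies.1 ((segmentList_coReach_iff hm _ _ _).2 (h w))
    choose D hD using h'
    obtain ⟨W, hW⟩ := (exists_list_mem_iff (List.finite_length_le (Fin s)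
      (witnessBound (2 * (elemInstrs M.encode).length + 2) (elemInstrs M.encode).length)))
    refine ⟨(m, W.map fun w => (w.map Fin.val, D w)), hm, ?_, ?_⟩
    · exact ⟨_, List.mem_map_of_mem ((hW []).2 (Nat.zero_le _)), rfl⟩
    · intro x hx
      obtain ⟨w, hw, rfl⟩ := List.mem_map.1 hx
      refine ⟨hD w, fun hlt a ha => ?_⟩
      exact ⟨_, List.mem_map_of_mem ((hW (⟨a, List.mem_range.1 ha⟩ :: w)).2
        (by simpa using hlt)), rfl⟩

/-- One missing word for each mode suffices, and no bound on its length is needed. -/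
theorem exists_showsNondense_iff (hM : M.ReversalBounded) :
    (∃ N, ShowsNondense M.encode N) ↔ ¬ DenseLanguage M.language := by
  rw [dense_iff hM]
  constructor
  · rintro ⟨N, hN⟩ ⟨m, hm, h⟩
    obtain ⟨x, hx, hxm, hlt, href⟩ := hN m hm
    obtain ⟨w, hw⟩ := CanLift.prf (β := List (Fin s)) x.2.1 hlt
    rw [← hw] at href
    exact href.not_coReach ((segmentList_coReach_iff hm _ _ _).2 (h w))
  · intro h
    push Not at h
    have h' : ∀ m : ℕ × ℕ, ∃ (w : List (Fin s)) (t : Table (ℕ × ElemState)), m ∈ segmentModes →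
        Refutes (segmentList (w.map Fin.val) m (elemInstrs M.encode)) (0, (4, [], 0))
          ((w.map Fin.val).length, (5, [], 0)) t := by
      intro m
      by_cases hm : m ∈ segmentModes
      · obtain ⟨w, hw⟩ := h m hm
        obtain ⟨t, ht⟩ := exists_refutes fun h => hw ((segmentList_coReach_iff hm _ _ _).1 h)
        exact ⟨w, t, fun _ => ht⟩
      · exact ⟨[], (0, [], [], [], []), fun h => absurd h hm⟩
    choose w t ht using h'
    refine ⟨segmentModes.map fun m => (m, (w m).map Fin.val, t m), fun m hm => ?_⟩
    refine ⟨_, List.mem_map_of_mem hm, rfl, ?_, ht m hm⟩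
    rintro _ ha
    obtain ⟨a, -, rfl⟩ := List.mem_map.1 ha
    exact a.isLt

end StackAutomaton

open Classical in
/-- The answer that the `n`-th piece of evidence gives about the density of the language. -/
noncomputable def densityAnswer (c : StackAutomatonCode) (n : ℕ) : Option Bool :=
  (Encodable.decode (α := DenseEvidence × NondenseEvidence) n).bind fun x =>
    if ShowsDense c x.1 then some true else if ShowsNondense c x.2 then some false else none

set_option synthInstance.maxSize 1000 in
set_option synthInstance.maxHeartbeats 200000 in
theorem primrec_densityAnswer : Primrec₂ densityAnswer := by
  refine Primrec.option_bind (Primrec.decode.comp Primrec.snd) ?_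
  unfold Primrec₂
  fun_prop

theorem StackAutomaton.exists_densityAnswer {q s g : ℕ} {M : StackAutomaton (Fin q) (Fin s) (Fin g)}
    (hM : M.ReversalBounded) : ∃ n b, b ∈ densityAnswer M.encode n := by
  by_cases h : DenseLanguage M.language
  · obtain ⟨E, hE⟩ := (exists_showsDense_iff hM).2 h
    exact ⟨Encodable.encode ((E, []) : DenseEvidence × NondenseEvidence), true,
      by simp only [densityAnswer, Encodable.encodek, Option.bind_some, if_pos hE, Option.mem_def]⟩
  · obtain ⟨N, hN⟩ := (exists_showsNondense_iff hM).2 h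
    -- `densityAnswer` tries the evidence for density first, so the dummy in that component must be
    -- known to fail.
    have hE : ¬ ShowsDense M.encode ((0, 0), []) := fun hE =>
      h ((exists_showsDense_iff hM).1 ⟨_, hE⟩)
    exact ⟨Encodable.encode ((((0, 0), []), N) : DenseEvidence × NondenseEvidence), false,
      by simp only [densityAnswer, Encodable.encodek, Option.bind_some, if_neg hE, if_pos hN,
        Option.mem_def]⟩

theorem StackAutomaton.eq_true_iff_of_mem_densityAnswer {q s g n : ℕ} {b : Bool}
    {M : StackAutomaton (Fin q) (Fin s) (Fin g)} (hM : M.ReversalBounded)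
    (h : b ∈ densityAnswer M.encode n) : b = true ↔ DenseLanguage M.language := by
  simp only [densityAnswer, Option.mem_def, Option.bind_eq_some_iff] at h
  obtain ⟨x, -, h⟩ := h
  split_ifs at h with h₁ h₂
  · obtain rfl := Option.some_injective _ h
    simpa using (exists_showsDense_iff hM).1 ⟨_, h₁⟩
  · obtain rfl := Option.some_injective _ h
    simpa using (exists_showsNondense_iff hM).1 ⟨_, h₂⟩

/-- There is an algorithm that, given a reversal-bounded one-way nondeterministic stack automaton,
halts and answers whether the language accepted by it is dense. -/
theorem mainTheorem3 :
    ∃ f : StackAutomatonCode →. Bool, Partrec f ∧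
      ∀ (q s g : ℕ) (M : StackAutomaton (Fin q) (Fin s) (Fin g)), M.ReversalBounded →
        ∃ b : Bool, f M.encode = Part.some b ∧ (b = true ↔ DenseLanguage M.language) := by
  refine ⟨fun c => Nat.rfindOpt (densityAnswer c), Partrec.rfindOpt primrec_densityAnswer.to_comp,
    fun q s g M hM => ?_⟩
  have hdom := Nat.rfindOpt_dom.2 (M.exists_densityAnswer hM)
  obtain ⟨n, hn⟩ := Nat.rfindOpt_spec (Part.get_mem hdom)
  exact ⟨_, (Part.some_get hdom).symm, M.eq_true_iff_of_mem_densityAnswer hM hn⟩
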